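/- Conventions. All complexes are homologically graded by $\mathbb{Z}$; $E_\bullet[1]$ is the complex with $E_\bullet[1]_n=E_{n-1}$ and differential $-d$; $\mathrm{Cone}(E_\bullet)$ is the cone of $\mathrm{id}_{E_\bullet}$, with its canonical inclusion $\beta:E_\bullet\to\mathrm{Cone}(E_\bullet)$. A sequence $0\to X_\bullet\xrightarrow{f}Y_\bullet\xrightarrow{g}Z_\bullet\to 0$ of complexes with $gf=0$ is *quasiexact* if $f$ is injective, $g$ is surjective and the complex $\operatorname{Ker} g/\operatorname{Im} f$ is acyclic. Let $R$ be an associative unital ring and $W$ a right $R$-module. Let $C_\bullet(\mathbb{Z})$ be the category of complexes of abelian groups and $C^{pf}_\bullet(R)$ the category of bounded complexes of finitely generated projective left $R$-modules. A functor $F:C^{pf}_\bullet(R)\to C_\bullet(\mathbb{Z})$ is *pointed* if $F(0)=0$; it is *admissible* if it is pointed, sends acyclic complexes to acyclic complexes, and sends short exact sequences of complexes to quasiexact sequences. Let $e_*(\mathsf{I}_\bullet)$ be the functor sending $V_\bullet$ to its underlying complex of abelian groups, and $\mathsf{I}_\bullet(W)$ the functor $V_\bullet\mapsto W\otimes_R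 V_\bullet$ (termwise). Sequences of functors are called quasiexact if they are so on each $V_\bullet$. A *DG elementary extension* of $e_*(\mathsf{I}_\bullet)$ by $\mathsf{I}_\bullet(W)$ satisfying the amplitude bound is a quasiexact sequence of functors $C^{pf}_\bullet(R)\to C_\bullet(\mathbb{Z})$ $$0\to \mathsf{I}_\bullet(W)[1]\xrightarrow{\ b\ } C_\bullet\xrightarrow{\ a\ } e_*(\mathsf{I}_\bullet)\to 0$$ with $C_\bullet$ admissible, such that for every integer $m$, if $V_\bullet\in C^{pf}_\bullet(R)$ vanishes in degrees $>m$, then $C_\bullet(V_\bullet)$ vanishes in degrees $>m+1$. A *right DG splitting* of it is a pointed functor $C^r_\bullet:C^{pf}_\bullet(R)\to C_\bullet(\mathbb{Z})$ with maps $r:C_\bullet\to C^r_\bullet$ and $a^r:C^r_\bullet\to\mathrm{Cone}(e_*(\mathsf{I}_\bullet))$ such that $a^r\circ r=\beta\circ a$ and the sequence $0\to \mathsf{I}_\bullet(W)[1]\xrightarrow{r\circ b}C^r_\bullet\xrightarrow{a^r}\mathrm{Cone}(e_*(\mathsf{I}_\bullet))\to 0$ is quasiexact. It is *strict* if the commutative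 square with sides $r$, $a$, $a^r$, $\beta$ is bicartesian (both a pullback and a pushout square). **Proposition.** Every DG elementary extension of $e_*(\mathsf{I}_\bullet)$ by $\mathsf{I}_\bullet(W)$ satisfying the amplitude bound admits a strict right DG splitting $\langle C^r_\bullet,r,a^r\rangle$ with $C^r_\bullet$ admissible. Such a splitting is unique up to isomorphism: for any two strict right DG splittings $\langle C^r_\bullet,r,a^r\rangle$ and $\langle \widetilde C^r_\bullet,\widetilde r,\widetilde a^r\rangle$ there is an isomorphism of functors $f:C^r_\bullet\cong\widetilde C^r_\bullet$ with $f\circ r=\widetilde r$ and $\widetilde a^r\circ f=a^r$. -/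

import Mathlib

open CategoryTheory CategoryTheory.Limits
open scoped TensorProduct

universe u

namespace DGSplitting

noncomputable section

/-! Chain complexes are homologically graded and indexed by `ℤ`: the differential of
`K : ChainComplex C ℤ` maps `K.X (i + 1)` to `K.X i`. -/

section Complexes

variable {C : Type*} [Category* C] [Abelian C]

/-- The homological shift `K[1]`: its term of degree `n` is `K_{n-1}`, its differential is `-d`. -/
def shift (K : ChainComplex C ℤ) : ChainComplex C ℤ where
  X n := K.X (n - 1)
  d i j := -K.d (i - 1) (j - 1)
  shape i j h := by
    rw [K.shape, neg_zero]
    intro h'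
    apply h
    change j - 1 + 1 = i - 1 at h'
    change j + 1 = i
    omega
  d_comp_d' i j k _ _ := by simp

variable (C) in
/-- The homological shift `K ↦ K[1]` as a functor. -/
def shiftFunctor : ChainComplex C ℤ ⥤ ChainComplex C ℤ where
  obj K := shift K
  map {K L} f :=
    { f := fun n => f.f (n - 1)
      comm' := fun i j _ => by
        change f.f (i - 1) ≫ (-L.d (i - 1) (j - 1)) = (-K.d (i - 1) (j - 1)) ≫ f.f (j - 1)
        rw [Preadditive.comp_neg, Preadditive.neg_comp, f.comm] }

variable (C) in
/-- `K ↦ Cone(K)`, the cone of the identity map of `K`; its term of degree `n` is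
`K_{n-1} ⊕ K_n`. -/
def coneFunctor : ChainComplex C ℤ ⥤ ChainComplex C ℤ where
  obj K := HomologicalComplex.homotopyCofiber (𝟙 K)
  map {K L} f := HomologicalComplex.homotopyCofiber.mapArrowHom (𝟙 K) (𝟙 L)
    (fun j => ⟨j + 1, rfl⟩) (Arrow.homMk f f (by simp))
  map_id K := HomologicalComplex.homotopyCofiber.mapArrowHom_id _ _
  map_comp f g := HomologicalComplex.homotopyCofiber.mapArrowHom_comp _ _ _ _ (Arrow.homMk f f (by simp)) (Arrow.homMk g g (by simp))

variable (C) in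
/-- The canonical inclusion `β : K ⟶ Cone(K)`. -/
def coneIncl : 𝟭 (ChainComplex C ℤ) ⟶ coneFunctor C where
  app K := HomologicalComplex.homotopyCofiber.inr (𝟙 K)
  naturality K L f := by
    simp [coneFunctor, HomologicalComplex.homotopyCofiber.mapArrowHom]

/-- A sequence `0 ⟶ X ⟶ Y ⟶ Z ⟶ 0` of complexes with maps `f`, `g` is quasiexact if
`g ∘ f = 0`, `f` is injective, `g` is surjective, and the complex `Ker g / Im f` is acyclic. -/
def QuasiExact {X Y Z : ChainComplex C ℤ} (f : X ⟶ Y) (g : Y ⟶ Z) : Prop :=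
  ∃ w : f ≫ g = 0, Mono f ∧ Epi g ∧ (ShortComplex.mk f g w).homology.Acyclic

/-- The complex `K` vanishes in degrees `> m`. -/
def ConcentratedLE (K : ChainComplex C ℤ) (m : ℤ) : Prop :=
  ∀ i : ℤ, m < i → IsZero (K.X i)

end Complexes

section Functors

variable (R : Type u) [Ring R]

/-- Finite-length complexes of finitely generated projective left `R`-modules. -/
def isPerfect : ObjectProperty (ChainComplex (ModuleCat.{u} R) ℤ) := fun K =>
  (∀ i : ℤ, Module.Finite R (K.X i) ∧ Module.Projective R (K.X i)) ∧
    ∃ m n : ℤ, ∀ i : ℤ, (i < m ∨ n < i) → IsZero (K.X i)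

/-- The category `C^{pf}_•(R)`. -/
abbrev Perf : Type (u + 1) := (isPerfect R).FullSubcategory

end Functors

section Admissible

variable {R : Type u} [Ring R] {S : Type*} [Ring S]

/-- A functor `C^{pf}_•(R) ⥤ C_•(S)` is pointed if it sends zero to zero. -/
def IsPointed (F : Perf R ⥤ ChainComplex (ModuleCat.{u} S) ℤ) : Prop :=
  ∀ V : Perf R, IsZero V.obj → IsZero (F.obj V)

/-- Admissible functors `C^{pf}_•(R) ⥤ C_•(S)`. -/
structure IsAdmissible (F : Perf R ⥤ ChainComplex (ModuleCat.{u} S) ℤ) : Prop where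
  pointed : IsPointed F
  acyclic : ∀ V : Perf R, V.obj.Acyclic → (F.obj V).Acyclic
  quasiExact : ∀ {X Y Z : Perf R} (f : X ⟶ Y) (g : Y ⟶ Z) (w : f.hom ≫ g.hom = 0),
    (ShortComplex.mk f.hom g.hom w).ShortExact → QuasiExact (F.map f) (F.map g)

end Admissible

section Tensor

variable (R : Type u) [Ring R] (W : Type u) [AddCommGroup W] [Module Rᵐᵒᵖ W]

/-- The subgroup of `W ⊗_ℤ V` generated by the elements `w r ⊗ v - w ⊗ r v`. -/
def tensorRel (V : Type u) [AddCommGroup V] [Module R V] : AddSubgroup (W ⊗[ℤ] V) :=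
  AddSubgroup.closure
    {t | ∃ (w : W) (r : R) (v : V), t = (MulOpposite.op r • w) ⊗ₜ[ℤ] v - w ⊗ₜ[ℤ] (r • v)}

/-- The tensor product `W ⊗_R V` of a right `R`-module `W` and a left `R`-module `V`,
an abelian group. -/
abbrev Tensor (V : Type u) [AddCommGroup V] [Module R V] : Type u :=
  (W ⊗[ℤ] V) ⧸ tensorRel R W V

/-- The map `W ⊗_R V ⟶ W ⊗_R V'` induced by an `R`-linear map `V ⟶ V'`. -/
def tensorMap {V V' : Type u} [AddCommGroup V] [Module R V] [AddCommGroup V'] [Module R V']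
    (f : V →ₗ[R] V') : Tensor R W V →+ Tensor R W V' :=
  QuotientAddGroup.map _ _
    (TensorProduct.map (LinearMap.id (R := ℤ) (M := W))
      f.toAddMonoidHom.toIntLinearMap).toAddMonoidHom (by
    refine (AddSubgroup.closure_le _).2 ?_
    rintro _ ⟨w, r, v, rfl⟩
    refine AddSubgroup.subset_closure ⟨w, r, f v, ?_⟩
    rw [map_sub]
    change _ - w ⊗ₜ[ℤ] (f (r • v)) = _
    rw [map_smul]
    rfl)

theorem tensor_hom_ext {V A : Type u} [AddCommGroup V] [Module R V] [AddCommGroup A]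
    {f g : Tensor R W V →+ A}
    (h : ∀ (w : W) (v : V), f (QuotientAddGroup.mk (w ⊗ₜ[ℤ] v)) =
      g (QuotientAddGroup.mk (w ⊗ₜ[ℤ] v))) : f = g := by
  refine QuotientAddGroup.addMonoidHom_ext _ (AddMonoidHom.ext fun x => ?_)
  induction x with
  | zero => rw [map_zero, map_zero]
  | add x y hx hy => rw [map_add, map_add, hx, hy]
  | tmul w v => exact h w v

/-- The additive functor `V ↦ W ⊗_R V` from left `R`-modules to abelian groups. -/
def tensorFunctor : ModuleCat.{u} R ⥤ ModuleCat.{u} ℤ where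
  obj V := ModuleCat.of ℤ (Tensor R W V)
  map f := ModuleCat.ofHom (tensorMap R W f.hom).toIntLinearMap
  map_id V := by
    refine ModuleCat.hom_ext (LinearMap.ext fun x => ?_)
    exact DFunLike.congr_fun (tensor_hom_ext R W (V := V) (f := tensorMap R W LinearMap.id)
      (g := AddMonoidHom.id _) fun w v => rfl) x
  map_comp f g := by
    refine ModuleCat.hom_ext (LinearMap.ext fun x => ?_)
    exact DFunLike.congr_fun (tensor_hom_ext R W (f := tensorMap R W (g.hom.comp f.hom))
      (g := (tensorMap R W g.hom).comp (tensorMap R W f.hom)) fun w v => rfl) x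

instance tensorFunctor_additive : (tensorFunctor R W).Additive where
  map_add {V V' f g} := by
    refine ModuleCat.hom_ext (LinearMap.ext fun x => ?_)
    exact DFunLike.congr_fun (tensor_hom_ext R W (f := tensorMap R W (f.hom + g.hom))
      (g := tensorMap R W f.hom + tensorMap R W g.hom) fun w v =>
      congrArg (QuotientAddGroup.mk (s := tensorRel R W V'))
        (TensorProduct.tmul_add w (f.hom v) (g.hom v))) x

/-- The functor `I_•(W) : C^{pf}_•(R) ⥤ C_•(ℤ)`, `V_• ↦ W ⊗_R V_•` termwise. -/
def tensorPerf : Perf R ⥤ ChainComplex (ModuleCat.{u} ℤ) ℤ :=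
  (isPerfect R).ι ⋙ (tensorFunctor R W).mapHomologicalComplex _

/-- The functor `e_*(I_•) : C^{pf}_•(R) ⥤ C_•(ℤ)` sending a complex of `R`-modules to the
underlying complex of abelian groups. -/
def forgetPerf : Perf R ⥤ ChainComplex (ModuleCat.{u} ℤ) ℤ :=
  (isPerfect R).ι ⋙ (ModuleCat.restrictScalars.{u} (Int.castRingHom R)).mapHomologicalComplex _

/-- A DG elementary extension of `e_*(I_•)` by `I_•(W)`: a quasiexact sequence
`0 ⟶ I_•(W)[1] ⟶ C_• ⟶ e_*(I_•) ⟶ 0` of functors, with `C_•` admissible and with `C_•(V_•)`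
concentrated in degrees `≤ m + 1` for any `V_•` concentrated in degrees `≤ m`. -/
structure ElementaryExtension where
  /-- the middle term `C_•` -/
  C : Perf R ⥤ ChainComplex (ModuleCat.{u} ℤ) ℤ
  /-- the map `I_•(W)[1] ⟶ C_•` -/
  b : tensorPerf R W ⋙ shiftFunctor (ModuleCat.{u} ℤ) ⟶ C
  /-- the map `C_• ⟶ e_*(I_•)` -/
  a : C ⟶ forgetPerf R
  quasiExact : ∀ V : Perf R, QuasiExact (b.app V) (a.app V)
  admissible : IsAdmissible C
  amplitude : ∀ (m : ℤ) (V : Perf R), ConcentratedLE V.obj m → ConcentratedLE (C.obj V) (m + 1)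

end Tensor

section Splitting

variable {R : Type u} [Ring R] {W : Type u} [AddCommGroup W] [Module Rᵐᵒᵖ W]

variable (R) in
/-- The functor `V_• ↦ Cone(V_•)` with values in complexes of abelian groups. -/
abbrev conePerf : Perf R ⥤ ChainComplex (ModuleCat.{u} ℤ) ℤ :=
  forgetPerf R ⋙ coneFunctor (ModuleCat.{u} ℤ)

variable (R) in
/-- The canonical inclusion `β : e_*(I_•) ⟶ Cone(e_*(I_•))`. -/
abbrev conePerfIncl : forgetPerf R ⟶ conePerf R :=
  Functor.whiskerLeft (forgetPerf R) (coneIncl (ModuleCat.{u} ℤ))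

/-- A right DG splitting of a DG elementary extension
`0 ⟶ I_•(W)[1] ⟶ C_• ⟶ e_*(I_•) ⟶ 0` with maps `b`, `a`: a pointed functor `C^r_•` with maps
`r : C_• ⟶ C^r_•`, `a^r : C^r_• ⟶ Cone(e_*(I_•))` such that `a^r ∘ r = β ∘ a` and
`0 ⟶ I_•(W)[1] ⟶ C^r_• ⟶ Cone(e_*(I_•)) ⟶ 0`, with maps `r ∘ b` and `a^r`, is quasiexact. -/
structure RightSplitting (φ : ElementaryExtension R W) where
  /-- the functor `C^r_•` -/
  Cr : Perf R ⥤ ChainComplex (ModuleCat.{u} ℤ) ℤ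
  pointed : IsPointed Cr
  /-- the map `r` -/
  r : φ.C ⟶ Cr
  /-- the map `a^r` -/
  ar : Cr ⟶ conePerf R
  comm : r ≫ ar = φ.a ≫ conePerfIncl R
  quasiExact : ∀ V : Perf R, QuasiExact ((φ.b ≫ r).app V) (ar.app V)

/-- A right DG splitting is strict if the square with sides `r`, `a`, `a^r`, `β` is
bicartesian. -/
def RightSplitting.IsStrict {φ : ElementaryExtension R W} (s : RightSplitting φ) : Prop :=
  BicartesianSq s.r φ.a s.ar (conePerfIncl R)

/-- Two right DG splittings are isomorphic if there is an isomorphism `C^r_• ≅ C'^r_•` of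
functors that is compatible with the maps `r` and `a^r`. -/
def RightSplitting.IsIsomorphic {φ : ElementaryExtension R W} (s t : RightSplitting φ) : Prop :=
  ∃ e : s.Cr ≅ t.Cr, s.r ≫ e.hom = t.r ∧ e.hom ≫ t.ar = s.ar

end Splitting

end

end DGSplitting

/-! The idea is to replace $C_\bullet$ by explicit elements. The disk of rank $k$ in degrees $m,m-1$
corepresents $V\mapsto V_m^k$ and the sphere corepresents $k$-tuples of $m$-cycles. So natural
functions $V_m^k\to C(V)_n$, additive or not, are elements of $C(\mathrm{disk})_n$, and identities
between them can be checked on the generators.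

Existence. Acyclicity of $C$ on disks, exactness of sphere → disk → sphere and acyclicity of
$\operatorname{Ker} a/\operatorname{Im} b$ yield a natural section $\tau$ of $a$ that commutes with
$d$ but need not be additive (`nonempty_naturalSection`). Its failure to be additive is measured by
a natural $\sigma:V_m\times V_m\to C(V)_{m+1}$ with $d\sigma(v,w)=\tau v+\tau
w-\tau(v+w)-\sigma(dv,dw)$ (`exists_disk_cocycle`). Put $C^r_i=C_i\times V_{i-1}$ with addition
twisted by $\sigma$ and $d(y,v)=(dy+\tau v,-dv)$. The equation for $d\sigma$ makes this $d$
additive, and $d\tau=\tau d$ gives $d^2=0$.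

Rigidity. That $\sigma$ is a symmetric cocycle follows from `eq_zero_of_natural`: a natural
$\psi:V_m^k\to C(V)_{m+1}$ with $d\psi(v)=-\psi(dv)$ that vanishes when at most one argument is
nonzero is zero. This rests on the amplitude bound: for $V$ in degrees $\le m$, all cycles of
$C(V)_{m+1}$ come from the additive functor $W\otimes_R V_m$.

Uniqueness. In a strict splitting $T$ the image of $r$ is the preimage of $e_*(\mathsf I_\bullet)$
under $a^r$. One constructs a natural $g:V_{i-1}\to T_i$ lifting the shifted summand of the cone,
with $dg(v)=r\tau v-g(dv)$ (`exists_section`). By rigidity, its failure to be additive is exactly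
$r\sigma$, so $r$ and $g$ together define an isomorphism from the model $C^r$ to $T$. -/

namespace DGSplitting

/-! ### Elementwise criteria for acyclicity and quasiexactness. -/

section Elementwise

variable {S : Type*} [Ring S]

theorem acyclic_iff (K : ChainComplex (ModuleCat.{u} S) ℤ) :
    K.Acyclic ↔ ∀ i j k : ℤ, j + 1 = i → k + 1 = j → ∀ x : K.X j, (K.d j k).hom x = 0 →
      ∃ y : K.X i, (K.d i j).hom y = x := by
  constructor
  · rintro h i j k rfl rfl x hx
    have := (HomologicalComplex.exactAt_iff' K (k + 1 + 1) (k + 1) k (by simp) (by simp)).1 (h _)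
    exact (ShortComplex.moduleCat_exact_iff _).1 this x hx
  · intro h j
    refine (HomologicalComplex.exactAt_iff' K (j + 1) j (j - 1) (by simp) (by simp)).2 ?_
    exact (ShortComplex.moduleCat_exact_iff _).2 fun x hx =>
      h (j + 1) j (j - 1) rfl (by omega) x hx

theorem exact_iff {X Y Z : ChainComplex (ModuleCat.{u} S) ℤ} (f : X ⟶ Y) (g : Y ⟶ Z)
    (w : f ≫ g = 0) : (ShortComplex.mk f g w).Exact ↔
      ∀ (i : ℤ) (y : Y.X i), (g.f i).hom y = 0 → ∃ x : X.X i, (f.f i).hom x = y := by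
  rw [HomologicalComplex.exact_iff_degreewise_exact]
  exact forall_congr' fun i => ShortComplex.moduleCat_exact_iff _

theorem mono_iff_injective {X Y : ChainComplex (ModuleCat.{u} S) ℤ} (f : X ⟶ Y) :
    Mono f ↔ ∀ i, Function.Injective (f.f i).hom := by
  constructor
  · intro h i
    exact (ModuleCat.mono_iff_injective _).1 inferInstance
  · intro h
    have : ∀ i, Mono (f.f i) := fun i => (ModuleCat.mono_iff_injective _).2 (h i)
    exact HomologicalComplex.mono_of_mono_f f this

theorem epi_iff_surjective {X Y : ChainComplex (ModuleCat.{u} S) ℤ} (f : X ⟶ Y) :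
    Epi f ↔ ∀ i, Function.Surjective (f.f i).hom := by
  constructor
  · intro h i
    exact (ModuleCat.epi_iff_surjective _).1 inferInstance
  · intro h
    have : ∀ i, Epi (f.f i) := fun i => (ModuleCat.epi_iff_surjective _).2 (h i)
    exact HomologicalComplex.epi_of_epi_f f this

theorem hom_d_comm {X Y : ChainComplex (ModuleCat.{u} S) ℤ} (f : X ⟶ Y) (i j : ℤ) (x : X.X i) :
    (Y.d i j).hom ((f.f i).hom x) = (f.f j).hom ((X.d i j).hom x) :=
  congrArg (fun φ => φ.hom x) (f.comm i j)

theorem d_d_apply (X : ChainComplex (ModuleCat.{u} S) ℤ) (i j k : ℤ) (x : X.X i) :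
    (X.d j k).hom ((X.d i j).hom x) = 0 :=
  congrArg (fun φ => φ.hom x) (X.d_comp_d i j k)

theorem comp_f_apply {X Y Z : ChainComplex (ModuleCat.{u} S) ℤ} (f : X ⟶ Y) (g : Y ⟶ Z) (i : ℤ)
    (x : X.X i) : (g.f i).hom ((f.f i).hom x) = ((f ≫ g).f i).hom x := rfl

/-- A class in $\operatorname{Ker} g/\operatorname{Im} f$ is a cycle when a representative has its
boundary in $\operatorname{Im} f$. This form turns all later work into element chasing. -/
theorem quasiExact_iff {X Y Z : ChainComplex (ModuleCat.{u} S) ℤ} (f : X ⟶ Y) (g : Y ⟶ Z) :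
    QuasiExact f g ↔ (∀ i x, (g.f i).hom ((f.f i).hom x) = 0) ∧
      (∀ i, Function.Injective (f.f i).hom) ∧ (∀ i, Function.Surjective (g.f i).hom) ∧
      ∀ i j k : ℤ, j + 1 = i → k + 1 = j → ∀ (y : Y.X j) (x : X.X k), (g.f j).hom y = 0 →
        (Y.d j k).hom y = (f.f k).hom x → ∃ (y' : Y.X i) (x' : X.X j), (g.f i).hom y' = 0 ∧
          y = (f.f j).hom x' + (Y.d i j).hom y' := by
  have hw : (∀ i x, (g.f i).hom ((f.f i).hom x) = 0) ↔ f ≫ g = 0 := by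
    constructor
    · intro h
      ext i x
      exact h i x
    · intro h i x
      rw [comp_f_apply, h]; rfl
  have key : ∀ w : f ≫ g = 0, (ShortComplex.mk f g w).homology.Acyclic ↔
      ∀ i j k : ℤ, j + 1 = i → k + 1 = j → ∀ (y : Y.X j) (x : X.X k), (g.f j).hom y = 0 →
        (Y.d j k).hom y = (f.f k).hom x → ∃ (y' : Y.X i) (x' : X.X j), (g.f i).hom y' = 0 ∧
          y = (f.f j).hom x' + (Y.d i j).hom y' := by
    intro w
    set s := ShortComplex.mk f g w
    have hi : ∀ i, Function.Injective (s.iCycles.f i).hom :=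
      (mono_iff_injective _).1 inferInstance
    have hp : ∀ i, Function.Surjective (s.homologyπ.f i).hom :=
      (epi_iff_surjective _).1 inferInstance
    have hc : ∀ (i : ℤ) (y : Y.X i), (g.f i).hom y = 0 → ∃ z, (s.iCycles.f i).hom z = y :=
      (exact_iff _ _ s.iCycles_g).1 (ShortComplex.exact_of_f_is_kernel _ s.cyclesIsKernel)
    have hh := (exact_iff _ _ s.toCycles_comp_homologyπ).1
      (ShortComplex.exact_of_g_is_cokernel _ s.homologyIsCokernel)
    have hg : ∀ i z, (g.f i).hom ((s.iCycles.f i).hom z) = 0 := fun i z => by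
      rw [comp_f_apply, show s.iCycles ≫ g = 0 from s.iCycles_g]; rfl
    have ht : ∀ i x, (s.iCycles.f i).hom ((s.toCycles.f i).hom x) = (f.f i).hom x := fun i x => by
      rw [comp_f_apply, show s.toCycles ≫ s.iCycles = f from s.toCycles_i]
    have hth : ∀ i x, (s.homologyπ.f i).hom ((s.toCycles.f i).hom x) = 0 := fun i x => by
      rw [comp_f_apply, s.toCycles_comp_homologyπ]; rfl
    rw [acyclic_iff]
    constructor
    · intro h i j k hij hjk y x hy hx
      obtain ⟨z, rfl⟩ := hc j y hy
      obtain ⟨t, ht'⟩ := h i j k hij hjk ((s.homologyπ.f j).hom z) (by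
        rw [hom_d_comm, show (s.cycles.d j k).hom z = (s.toCycles.f k).hom x from
          hi k (by rw [← hom_d_comm, hx, ht]), hth])
      obtain ⟨z', rfl⟩ := hp i t
      obtain ⟨x', hx'⟩ := hh j (z - (s.cycles.d i j).hom z') (by
        rw [map_sub, ← ht', hom_d_comm, sub_self])
      refine ⟨(s.iCycles.f i).hom z', x', hg _ _, ?_⟩
      rw [← ht, hx', map_sub, hom_d_comm, sub_add_cancel]
    · intro h i j k hij hjk t ht'
      obtain ⟨z, rfl⟩ := hp j t
      rw [hom_d_comm] at ht'
      obtain ⟨x, hx⟩ := hh k _ ht'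
      obtain ⟨y', x', hy', hyx⟩ := h i j k hij hjk ((s.iCycles.f j).hom z) x (hg _ _) (by
        rw [hom_d_comm, ← ht, hx])
      obtain ⟨z', rfl⟩ := hc i y' hy'
      refine ⟨(s.homologyπ.f i).hom z', ?_⟩
      rw [hom_d_comm, show z = (s.toCycles.f j).hom x' + (s.cycles.d i j).hom z' from
        hi j (by rw [hyx, map_add, ht, hom_d_comm]), map_add, hth, zero_add]
  rw [hw]
  constructor
  · rintro ⟨w, hf, hg, h⟩
    exact ⟨w, (mono_iff_injective _).1 hf, (epi_iff_surjective _).1 hg, (key w).1 h⟩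
  · rintro ⟨w, hf, hg, h⟩
    exact ⟨w, (mono_iff_injective _).2 hf, (epi_iff_surjective _).2 hg, (key w).2 h⟩

end Elementwise

end DGSplitting

namespace DGSplitting

noncomputable section

/-! ### Disks and spheres, corepresenting elements and cycles. -/

section FreeObjects

variable (R : Type u) [Ring R] (k : ℕ)

/-- The free module of rank `k`. -/
abbrev freeMod : ModuleCat.{u} R := ModuleCat.of R (Fin k → R)

variable {R k}

/-- The map from a free module given by a family of elements. -/
def freeHom {M : ModuleCat.{u} R} (v : Fin k → M) : freeMod R k ⟶ M :=
  ModuleCat.ofHom (Fintype.linearCombination R v)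

variable (R k) in
/-- The standard generators of the free module. -/
def freeGen (a : Fin k) : freeMod R k := Pi.single a (1 : R)

theorem freeHom_gen {M : ModuleCat.{u} R} (v : Fin k → M) (a : Fin k) :
    (freeHom v).hom (freeGen R k a) = v a := by
  change Fintype.linearCombination R v (Pi.single a 1) = v a
  rw [Fintype.linearCombination_apply_single, one_smul]

theorem free_hom_ext {M : ModuleCat.{u} R} {f g : freeMod R k ⟶ M}
    (h : ∀ a, f.hom (freeGen R k a) = g.hom (freeGen R k a)) : f = g :=
  ModuleCat.hom_ext (LinearMap.pi_ext' fun a => LinearMap.ext_ring (h a))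

theorem down_rel {l m : ℤ} (h : l + 1 = m) : (ComplexShape.down ℤ).Rel m l := h

theorem isPerfect_of {K : ChainComplex (ModuleCat.{u} R) ℤ} (m n : ℤ)
    (h : ∀ i, ¬ IsZero (K.X i) → Nonempty (K.X i ≅ freeMod R k))
    (hK : ∀ i : ℤ, (i < m ∨ n < i) → IsZero (K.X i)) : isPerfect R K := by
  refine ⟨fun i => ?_, m, n, hK⟩
  by_cases hi : IsZero (K.X i)
  · have := ModuleCat.subsingleton_of_isZero hi
    exact ⟨inferInstance, inferInstance⟩
  · obtain ⟨e⟩ := h i hi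
    exact ⟨Module.Finite.equiv e.symm.toLinearEquiv,
      Module.Projective.of_equiv e.symm.toLinearEquiv⟩

variable (R k)

/-- The complex `R^k ⟶ R^k` in degrees `m`, `m - 1`. -/
def disk (m : ℤ) : Perf R :=
  ⟨HomologicalComplex.double (𝟙 (freeMod R k)) (down_rel (sub_add_cancel m 1)), by
    refine isPerfect_of (k := k) (m - 1) m (fun i hi => ?_) (fun i hi =>
      HomologicalComplex.isZero_double_X _ _ _ (by omega) (by omega))
    by_cases h : i = m
    · subst h
      exact ⟨HomologicalComplex.doubleXIso₀ _ _⟩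
    by_cases h' : i = m - 1
    · subst h'
      exact ⟨HomologicalComplex.doubleXIso₁ _ _ (by omega)⟩
    · exact (hi (HomologicalComplex.isZero_double_X _ _ _ h h')).elim⟩

/-- The complex `R^k` in degree `m`. -/
def sphere (m : ℤ) : Perf R :=
  ⟨(HomologicalComplex.single _ (ComplexShape.down ℤ) m).obj (freeMod R k), by
    refine isPerfect_of (k := k) m m (fun i hi => ?_) (fun i hi =>
      HomologicalComplex.isZero_single_obj_X _ _ _ _ (by omega))
    by_cases h : i = m
    · subst h
      exact ⟨HomologicalComplex.singleObjXSelf _ _ _⟩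
    · exact (hi (HomologicalComplex.isZero_single_obj_X _ _ _ _ h)).elim⟩

variable {R k}

theorem isZero_disk_X {m i : ℤ} (h : i ≠ m) (h' : i + 1 ≠ m) : IsZero ((disk R k m).obj.X i) :=
  HomologicalComplex.isZero_double_X _ (down_rel (sub_add_cancel m 1)) _ h (by omega)

theorem isZero_sphere_X {m i : ℤ} (h : i ≠ m) : IsZero ((sphere R k m).obj.X i) :=
  HomologicalComplex.isZero_single_obj_X _ _ _ _ h

variable (R k) in
/-- The top term of the disk. -/
def diskIso (m : ℤ) : (disk R k m).obj.X m ≅ freeMod R k :=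
  HomologicalComplex.doubleXIso₀ (𝟙 (freeMod R k)) (down_rel (sub_add_cancel m 1))

variable (R k) in
/-- The nonzero term of the sphere. -/
def sphereIso (m : ℤ) : (sphere R k m).obj.X m ≅ freeMod R k :=
  HomologicalComplex.singleObjXSelf (ComplexShape.down ℤ) m (freeMod R k)

variable (R k) in
/-- The generators of `disk R k m` in degree `m`. -/
def diskGen (m : ℤ) (a : Fin k) : (disk R k m).obj.X m :=
  (diskIso R k m).inv.hom (freeGen R k a)

variable (R k) in
/-- The generators of `sphere R k m` in degree `m`. -/
def sphereGen (m : ℤ) (a : Fin k) : (sphere R k m).obj.X m :=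
  (sphereIso R k m).inv.hom (freeGen R k a)

/-- The map from a disk classified by elements of degree `m`. -/
def diskHom {V : Perf R} {m : ℤ} (v : Fin k → V.obj.X m) : disk R k m ⟶ V :=
  ⟨HomologicalComplex.mkHomFromDouble (down_rel (sub_add_cancel m 1)) (by omega) (freeHom v)
    (freeHom v ≫ V.obj.d m (m - 1))
    (by simp) (fun _ _ => by simp)⟩

theorem freeHom_comp_d {V : Perf R} {m : ℤ} (z : Fin k → V.obj.X m)
    (hz : ∀ a l, (V.obj.d m l).hom (z a) = 0) (l : ℤ) : freeHom z ≫ V.obj.d m l = 0 :=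
  free_hom_ext fun a => by
    change (V.obj.d m l).hom ((freeHom z).hom (freeGen R k a)) = 0
    rw [freeHom_gen, hz]

/-- The map from a sphere classified by cycles of degree `m`. -/
def sphereHom {V : Perf R} {m : ℤ} (z : Fin k → V.obj.X m)
    (hz : ∀ a l, (V.obj.d m l).hom (z a) = 0) : sphere R k m ⟶ V :=
  ⟨HomologicalComplex.mkHomFromSingle (freeHom z) (fun l _ => freeHom_comp_d z hz l)⟩

theorem diskHom_gen {V : Perf R} {m : ℤ} (v : Fin k → V.obj.X m) (a : Fin k) :
    ((diskHom v).hom.f m).hom (diskGen R k m a) = v a := by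
  have h : (diskHom v).hom.f m = (diskIso R k m).hom ≫ freeHom v :=
    HomologicalComplex.mkHomFromDouble_f₀ (K := V.obj) (down_rel (sub_add_cancel m 1)) (by omega)
      (freeHom v) (freeHom v ≫ V.obj.d m (m - 1)) (by simp) (fun _ _ => by simp)
  exact (congrArg (fun φ => φ.hom (freeGen R k a)) ((Iso.inv_comp_eq _).2 h)).trans
    (freeHom_gen v a)

theorem sphereHom_gen {V : Perf R} {m : ℤ} (z : Fin k → V.obj.X m)
    (hz : ∀ a l, (V.obj.d m l).hom (z a) = 0) (a : Fin k) :
    ((sphereHom z hz).hom.f m).hom (sphereGen R k m a) = z a := by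
  have h : (sphereHom z hz).hom.f m = (sphereIso R k m).hom ≫ freeHom z :=
    HomologicalComplex.mkHomFromSingle_f (c := ComplexShape.down ℤ) (K := V.obj)
      (freeHom z) (fun l _ => freeHom_comp_d z hz l)
  exact (congrArg (fun φ => φ.hom (freeGen R k a)) ((Iso.inv_comp_eq _).2 h)).trans
    (freeHom_gen z a)

theorem disk_hom_ext {V : Perf R} {m : ℤ} {f g : disk R k m ⟶ V}
    (h : ∀ a, (f.hom.f m).hom (diskGen R k m a) = (g.hom.f m).hom (diskGen R k m a)) : f = g := by
  let c := HomologicalComplex.evalCompCoyonedaCorepresentableByDoubleId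
    (down_rel (sub_add_cancel m 1)) (by omega) (freeMod R k)
  have : f.hom = g.hom := (c.homEquiv (Y := V.obj)).injective (free_hom_ext h)
  exact ObjectProperty.hom_ext _ this

theorem sphere_hom_ext {V : Perf R} {m : ℤ} {f g : sphere R k m ⟶ V}
    (h : ∀ a, (f.hom.f m).hom (sphereGen R k m a) = (g.hom.f m).hom (sphereGen R k m a)) :
    f = g := by
  refine ObjectProperty.hom_ext _ (HomologicalComplex.from_single_hom_ext ?_)
  exact (cancel_epi (sphereIso R k m).inv).1 (free_hom_ext h)

theorem diskHom_comp {V V' : Perf R} {m : ℤ} (v : Fin k → V.obj.X m) (g : V ⟶ V') :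
    diskHom v ≫ g = diskHom fun a => (g.hom.f m).hom (v a) :=
  disk_hom_ext fun a => by
    rw [diskHom_gen]
    exact congrArg (g.hom.f m).hom (diskHom_gen v a)

theorem sphereHom_comp {V V' : Perf R} {m : ℤ} (z : Fin k → V.obj.X m)
    (hz : ∀ a l, (V.obj.d m l).hom (z a) = 0) (g : V ⟶ V') :
    sphereHom z hz ≫ g = sphereHom (fun a => (g.hom.f m).hom (z a))
      (fun a l => by rw [hom_d_comm, hz, map_zero]) :=
  sphere_hom_ext fun a => by
    rw [sphereHom_gen]
    exact congrArg (g.hom.f m).hom (sphereHom_gen z hz a)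

theorem sphere_d {m i j : ℤ} (x : (sphere R k m).obj.X i) :
    ((sphere R k m).obj.d i j).hom x = 0 := by
  have : (sphere R k m).obj.d i j = 0 := HomologicalComplex.single_obj_d _ _ _ _ _
  rw [this]; rfl

theorem isIso_disk_d {l m : ℤ} (h : l + 1 = m) : IsIso ((disk R k m).obj.d m l) := by
  obtain rfl : l = m - 1 := by omega
  have h : (disk R k m).obj.d m (m - 1) = _ :=
    HomologicalComplex.double_d _ (down_rel (sub_add_cancel m 1)) (by omega)
  rw [h, Category.id_comp]
  exact (HomologicalComplex.doubleXIso₀ (𝟙 (freeMod R k)) (down_rel (sub_add_cancel m 1)) ≪≫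
    (HomologicalComplex.doubleXIso₁ _ (down_rel (sub_add_cancel m 1)) (by omega)).symm).isIso_hom

theorem disk_acyclic (m : ℤ) : (disk R k m).obj.Acyclic := by
  rw [acyclic_iff]
  rintro i j n rfl rfl x hx
  by_cases h : n + 1 = m
  · subst h
    have := isIso_disk_d (R := R) (k := k) (rfl : n + 1 = _)
    exact ⟨0, by rw [map_zero]; exact
      ((ModuleCat.mono_iff_injective _).1 inferInstance (hx.trans (map_zero _).symm)).symm⟩
  by_cases h' : n + 1 + 1 = m
  · subst h'
    have := isIso_disk_d (R := R) (k := k) (rfl : n + 1 + 1 = _)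
    exact (ModuleCat.epi_iff_surjective _).1 inferInstance x
  · have := ModuleCat.subsingleton_of_isZero (isZero_disk_X (R := R) (k := k) h h')
    exact ⟨0, Subsingleton.elim _ _⟩

theorem concentratedLE_disk (m : ℤ) : ConcentratedLE (disk R k m).obj m := fun _ h =>
  isZero_disk_X (by omega) (by omega)

theorem concentratedLE_sphere (m : ℤ) : ConcentratedLE (sphere R k m).obj m := fun _ h =>
  isZero_sphere_X (by omega)

variable (R k) in
/-- The canonical projection from the disk to the sphere. -/
abbrev diskToSphere (m : ℤ) : disk R k m ⟶ sphere R k m := diskHom (sphereGen R k m)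

variable (R k) in
/-- The inclusion of the boundary sphere into the disk. -/
abbrev sphereToDisk (l m : ℤ) : sphere R k l ⟶ disk R k m :=
  sphereHom (fun a => ((disk R k m).obj.d m l).hom (diskGen R k m a))
    (fun _ _ => d_d_apply _ _ _ _ _)

theorem isIso_diskToSphere (m : ℤ) : IsIso ((diskToSphere R k m).hom.f m) := by
  have h : (diskIso R k m).inv ≫ (diskToSphere R k m).hom.f m = (sphereIso R k m).inv :=
    free_hom_ext fun a => diskHom_gen _ a
  rw [Iso.inv_comp_eq] at h
  rw [h]
  infer_instance

theorem isIso_sphereToDisk {l m : ℤ} (h : l + 1 = m) : IsIso ((sphereToDisk R k l m).hom.f l) := by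
  have h' : (sphereIso R k l).inv ≫ (sphereToDisk R k l m).hom.f l =
      (diskIso R k m).inv ≫ (disk R k m).obj.d m l :=
    free_hom_ext fun a => sphereHom_gen _ (fun _ _ => d_d_apply _ _ _ _ _) a
  rw [Iso.inv_comp_eq] at h'
  have := isIso_disk_d (R := R) (k := k) h
  rw [h']
  infer_instance

theorem sphereToDisk_diskToSphere {l m : ℤ} (h : l + 1 = m) :
    (sphereToDisk R k l m).hom ≫ (diskToSphere R k m).hom = 0 := by
  ext i x
  by_cases hi : i = m
  · subst hi
    have := ModuleCat.subsingleton_of_isZero (isZero_sphere_X (R := R) (k := k)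
      (show i ≠ l by omega))
    rw [Subsingleton.elim x 0, map_zero, map_zero]
  · have := ModuleCat.subsingleton_of_isZero (isZero_sphere_X (R := R) (k := k) hi)
    exact Subsingleton.elim _ _

/-- The only short exact sequence to which admissibility of $C$ is applied: it makes
$C(\mathrm{disk})\to C(\mathrm{sphere})$ surjective. -/
theorem shortExact_disk {l m : ℤ} (h : l + 1 = m) :
    (ShortComplex.mk (sphereToDisk R k l m).hom (diskToSphere R k m).hom
      (sphereToDisk_diskToSphere h)).ShortExact := by
  have h₁ := isIso_diskToSphere (R := R) (k := k) m
  have h₂ := isIso_sphereToDisk (R := R) (k := k) h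
  have hm : Mono (sphereToDisk R k l m).hom := by
    rw [mono_iff_injective]
    intro i
    by_cases hi : i = l
    · subst hi
      exact (ModuleCat.mono_iff_injective _).1 inferInstance
    · have := ModuleCat.subsingleton_of_isZero (isZero_sphere_X (R := R) (k := k) hi)
      exact Function.injective_of_subsingleton _
  have he : Epi (diskToSphere R k m).hom := by
    rw [epi_iff_surjective]
    intro i
    by_cases hi : i = m
    · subst hi
      exact (ModuleCat.epi_iff_surjective _).1 inferInstance
    · have := ModuleCat.subsingleton_of_isZero (isZero_sphere_X (R := R) (k := k) hi)
      exact fun y => ⟨0, Subsingleton.elim _ _⟩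
  refine ⟨(exact_iff _ _ _).2 fun i y hy => ?_⟩
  by_cases hi : i = m
  · subst hi
    refine ⟨0, ?_⟩
    rw [map_zero]
    exact ((ModuleCat.mono_iff_injective _).1 inferInstance (hy.trans (map_zero _).symm)).symm
  by_cases hi' : i = l
  · subst hi'
    exact (ModuleCat.epi_iff_surjective _).1 inferInstance y
  · have := ModuleCat.subsingleton_of_isZero (isZero_disk_X (R := R) (k := k) hi (by omega))
    exact ⟨0, Subsingleton.elim _ _⟩

end FreeObjects

end

end DGSplitting

namespace DGSplitting

noncomputable section

/-! ### Pointed functors on elements. -/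

section FunctorElements

variable {R : Type u} [Ring R] {S : Type*} [Ring S] (G : Perf R ⥤ ChainComplex (ModuleCat.{u} S) ℤ)

/-- The action of a functor on elements of degree `n`. -/
def mapElt {V V' : Perf R} (g : V ⟶ V') (n : ℤ) : (G.obj V).X n →ₗ[S] (G.obj V').X n :=
  ((G.map g).f n).hom

theorem mapElt_comp {V V' V'' : Perf R} (g : V ⟶ V') (h : V' ⟶ V'') (n : ℤ) (x : (G.obj V).X n) :
    mapElt G h n (mapElt G g n x) = mapElt G (g ≫ h) n x := by
  rw [mapElt, mapElt, mapElt, G.map_comp]; rfl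

theorem mapElt_id (V : Perf R) (n : ℤ) (x : (G.obj V).X n) : mapElt G (𝟙 V) n x = x := by
  rw [mapElt, G.map_id]; rfl

theorem d_mapElt {V V' : Perf R} (g : V ⟶ V') (i j : ℤ) (x : (G.obj V).X i) :
    ((G.obj V').d i j).hom (mapElt G g i x) = mapElt G g j (((G.obj V).d i j).hom x) :=
  hom_d_comm _ _ _ _

variable {G}

theorem mapElt_app {H : Perf R ⥤ ChainComplex (ModuleCat.{u} S) ℤ} (α : G ⟶ H) {V V' : Perf R}
    (g : V ⟶ V') (n : ℤ) (x : (G.obj V).X n) :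
    mapElt H g n (((α.app V).f n).hom x) = ((α.app V').f n).hom (mapElt G g n x) :=
  (congrArg (fun f : G.obj V ⟶ H.obj V' => (f.f n).hom x) (α.naturality g)).symm

/-- A zero object of `Perf R`. -/
def zeroPerf : Perf R := disk R 0 0

theorem isZero_zeroPerf : IsZero (zeroPerf (R := R)).obj := by
  rw [IsZero.iff_id_eq_zero]
  exact congrArg InducedCategory.Hom.hom
    (disk_hom_ext (f := 𝟙 zeroPerf) (g := ⟨0⟩) fun a => a.elim0)

/-- A zero map factors through a zero object, so pointedness suffices; additivity of the functor is
not available. -/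
theorem mapElt_zero (hG : IsPointed G) {V V' : Perf R} {g : V ⟶ V'} (hg : g.hom = 0) (n : ℤ)
    (x : (G.obj V).X n) : mapElt G g n x = 0 := by
  have hz : g = (⟨0⟩ : V ⟶ zeroPerf) ≫ (⟨0⟩ : zeroPerf ⟶ V') :=
    ObjectProperty.hom_ext _ (by rw [hg]; exact comp_zero.symm)
  have := ModuleCat.subsingleton_of_isZero
    ((HomologicalComplex.eval _ _ n).map_isZero (hG zeroPerf isZero_zeroPerf))
  change Subsingleton ((G.obj zeroPerf).X n) at this
  rw [hz, ← mapElt_comp, Subsingleton.elim (mapElt G _ n x) 0, map_zero]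

variable {k : ℕ}

theorem mapElt_diskHom_zero (hG : IsPointed G) {m n : ℤ} {V : Perf R} {v : Fin k → V.obj.X m}
    (hv : ∀ a, v a = 0) (x : (G.obj (disk R k m)).X n) : mapElt G (diskHom v) n x = 0 :=
  mapElt_zero hG (congrArg InducedCategory.Hom.hom (disk_hom_ext (g := ⟨0⟩) fun a =>
    (diskHom_gen v a).trans (hv a))) n x

end FunctorElements

/-! ### Elements of an elementary extension; rigidity of natural functions. -/

section ExtensionElements

variable {R : Type u} [Ring R] {W : Type u} [AddCommGroup W] [Module Rᵐᵒᵖ W]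
  (φ : ElementaryExtension R W)

/-- The map `a` on elements. -/
def aElt (V : Perf R) (n : ℤ) : (φ.C.obj V).X n →+ V.obj.X n :=
  ((φ.a.app V).f n).hom.toAddMonoidHom

/-- The map `b` on elements. -/
def bElt (V : Perf R) (n : ℤ) : ((tensorPerf R W).obj V).X (n - 1) →ₗ[ℤ] (φ.C.obj V).X n :=
  ((φ.b.app V).f n).hom

variable {φ}

theorem aElt_mapElt {V V' : Perf R} (g : V ⟶ V') (n : ℤ) (x : (φ.C.obj V).X n) :
    aElt φ V' n (mapElt φ.C g n x) = (g.hom.f n).hom (aElt φ V n x) :=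
  (mapElt_app φ.a g n x).symm

theorem aElt_d {V : Perf R} (i j : ℤ) (x : (φ.C.obj V).X i) :
    aElt φ V j (((φ.C.obj V).d i j).hom x) = (V.obj.d i j).hom (aElt φ V i x) :=
  (hom_d_comm (S := ℤ) (φ.a.app V) i j x).symm

theorem mapElt_bElt {V V' : Perf R} (g : V ⟶ V') (n : ℤ)
    (t : ((tensorPerf R W).obj V).X (n - 1)) :
    mapElt φ.C g n (bElt φ V n t) = bElt φ V' n (mapElt (tensorPerf R W) g (n - 1) t) :=
  mapElt_app φ.b g n t

theorem d_bElt {V : Perf R} (i j : ℤ) (t : ((tensorPerf R W).obj V).X (i - 1)) :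
    ((φ.C.obj V).d i j).hom (bElt φ V i t) =
      -bElt φ V j ((((tensorPerf R W).obj V).d (i - 1) (j - 1)).hom t) := by
  rw [← map_neg]
  exact hom_d_comm (φ.b.app V) i j t

theorem bElt_injective (V : Perf R) (n : ℤ) : Function.Injective (bElt φ V n) :=
  ((quasiExact_iff _ _).1 (φ.quasiExact V)).2.1 n

theorem aElt_surjective (V : Perf R) (n : ℤ) : Function.Surjective (aElt φ V n) :=
  ((quasiExact_iff _ _).1 (φ.quasiExact V)).2.2.1 n

theorem aElt_bElt {V : Perf R} {n : ℤ} (t : ((tensorPerf R W).obj V).X (n - 1)) :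
    aElt φ V n (bElt φ V n t) = 0 :=
  ((quasiExact_iff _ _).1 (φ.quasiExact V)).1 n t

theorem exists_eq_bElt_add {V : Perf R} {i j k : ℤ} (hi : j + 1 = i) (hk : k + 1 = j)
    (x : (φ.C.obj V).X j) (hx : aElt φ V j x = 0) (t : ((tensorPerf R W).obj V).X (k - 1))
    (ht : ((φ.C.obj V).d j k).hom x = bElt φ V k t) :
    ∃ (y : (φ.C.obj V).X i) (t' : ((tensorPerf R W).obj V).X (j - 1)), aElt φ V i y = 0 ∧
      x = bElt φ V j t' + ((φ.C.obj V).d i j).hom y :=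
  ((quasiExact_iff _ _).1 (φ.quasiExact V)).2.2.2 i j k hi hk x t hx ht

theorem subsingleton_tensorPerf {V : Perf R} {n : ℤ} (h : IsZero (V.obj.X n)) :
    Subsingleton (((tensorPerf R W).obj V).X n) :=
  ModuleCat.subsingleton_of_isZero ((tensorFunctor R W).map_isZero h)

/-- In degree $j$ the image of $b$ is $W\otimes_R V_{j-1}$, which is zero here, so acyclicity of the
quotient becomes exactness of $\operatorname{Ker} a$ itself in degree $j$. -/
theorem exists_d_eq {V : Perf R} {i j k : ℤ} (hi : j + 1 = i) (hk : k + 1 = j)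
    (hV : IsZero (V.obj.X k)) (x : (φ.C.obj V).X j) (hx : aElt φ V j x = 0)
    (hd : ((φ.C.obj V).d j k).hom x = 0) :
    ∃ y : (φ.C.obj V).X i, aElt φ V i y = 0 ∧ ((φ.C.obj V).d i j).hom y = x := by
  obtain ⟨y, t, hy, rfl⟩ := exists_eq_bElt_add hi hk x hx 0 (by rw [hd, map_zero])
  obtain rfl : k = j - 1 := by omega
  have := subsingleton_tensorPerf (W := W) hV
  exact ⟨y, hy, by rw [Subsingleton.elim t 0, map_zero, zero_add]⟩

/-- The amplitude bound enters here: $C(V)_{m+2}=0$ leaves no boundaries in degree $m+1$, and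
$V_{m+1}=0$ puts everything in $\operatorname{Ker} a$. -/
theorem exists_bElt_eq {V : Perf R} {m n : ℤ} (hn : m + 1 = n) (hV : ConcentratedLE V.obj m)
    (x : (φ.C.obj V).X n) (hd : ((φ.C.obj V).d n m).hom x = 0) : ∃ t, bElt φ V n t = x := by
  have h₁ := ModuleCat.subsingleton_of_isZero (hV n (by omega))
  have h₂ := ModuleCat.subsingleton_of_isZero (φ.amplitude m V hV (n + 1) (by omega))
  obtain ⟨y, t, -, rfl⟩ := exists_eq_bElt_add (rfl : n + 1 = _) hn x (Subsingleton.elim _ _) 0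
    (by rw [hd, map_zero])
  exact ⟨t, by rw [Subsingleton.elim y 0, map_zero, add_zero]⟩

/-- A top-degree cycle is $b(t)$ with $dt=0$, and the differential of the disk is invertible, also
after tensoring with $W$. -/
theorem disk_injective {k : ℕ} {m n : ℤ} (hn : m + 1 = n) (x : (φ.C.obj (disk R k m)).X n)
    (hd : ((φ.C.obj (disk R k m)).d n m).hom x = 0) : x = 0 := by
  obtain ⟨t, rfl⟩ := exists_bElt_eq hn (concentratedLE_disk m) x hd
  obtain rfl : m = n - 1 := by omega
  rw [d_bElt, neg_eq_zero] at hd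
  have h := bElt_injective _ _ (hd.trans (map_zero _).symm)
  have := isIso_disk_d (R := R) (k := k) (sub_add_cancel (n - 1) 1)
  have h' : Function.Injective
      (((tensorPerf R W).obj (disk R k (n - 1))).d (n - 1) (n - 1 - 1)).hom :=
    (ModuleCat.mono_iff_injective _).1
      (inferInstanceAs (Mono ((tensorFunctor R W).map ((disk R k (n - 1)).obj.d _ _))))
  rw [h' (h.trans (map_zero _).symm), map_zero]

variable (R) in
/-- The idempotents of the sphere corresponding to its generators. -/
def sphereIdem (k : ℕ) (m : ℤ) (a : Fin k) : sphere R k m ⟶ sphere R k m :=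
  sphereHom (fun b => if b = a then sphereGen R k m b else 0) (fun _ _ => sphere_d _)

theorem sum_sphereIdem (k : ℕ) (m : ℤ) : ∑ a, (sphereIdem R k m a).hom.f m = 𝟙 _ := by
  refine (cancel_epi (sphereIso R k m).inv).1 (free_hom_ext fun b => ?_)
  change (∑ a, (sphereIdem R k m a).hom.f m).hom (sphereGen R k m b) = sphereGen R k m b
  rw [ModuleCat.hom_sum, LinearMap.sum_apply, Finset.sum_eq_single b]
  · exact (sphereHom_gen _ (fun _ _ => sphere_d _) b).trans (if_pos rfl)
  · intro a _ ha
    exact (sphereHom_gen _ (fun _ _ => sphere_d _) b).trans (if_neg ha.symm)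
  · simp

theorem eq_zero_of_sphereIdem {k : ℕ} {m : ℤ}
    (t : (tensorFunctor R W).obj ((sphere R k m).obj.X m))
    (ht : ∀ a, ((tensorFunctor R W).map ((sphereIdem R k m a).hom.f m)).hom t = 0) : t = 0 := by
  have hs : ∑ a, (tensorFunctor R W).map ((sphereIdem R k m a).hom.f m) = 𝟙 _ := by
    rw [← Functor.map_sum, sum_sphereIdem, CategoryTheory.Functor.map_id]
  have := congrArg (fun f => f.hom t) hs
  rw [ModuleCat.hom_sum, LinearMap.sum_apply] at this
  exact this.symm.trans (Finset.sum_eq_zero fun a _ => ht a)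

/-- Although $C$ need not be additive, a top-degree cycle lies in $W\otimes_R R^k$, where the
idempotents do sum to the identity. -/
theorem sphere_injective {k : ℕ} {m n : ℤ} (hn : m + 1 = n) (x : (φ.C.obj (sphere R k m)).X n)
    (hd : ((φ.C.obj (sphere R k m)).d n m).hom x = 0)
    (h : ∀ a, mapElt φ.C (sphereIdem R k m a) n x = 0) : x = 0 := by
  obtain ⟨t, rfl⟩ := exists_bElt_eq hn (concentratedLE_sphere m) x hd
  obtain rfl : m = n - 1 := by omega
  have ht : ∀ a, mapElt (tensorPerf R W) (sphereIdem R k (n - 1) a) (n - 1) t = 0 := fun a =>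
    bElt_injective _ _ (by rw [← mapElt_bElt, h, map_zero])
  exact (congrArg (bElt φ _ n) (eq_zero_of_sphereIdem t ht)).trans (map_zero _)

/-- On the sphere, $\psi$ of the generators is a top-degree cycle killed by every idempotent, so
$\psi$ vanishes on cycles. On the disk its boundary is therefore zero, and `disk_injective` applies.
-/
theorem eq_zero_of_natural {k : ℕ}
    (ψ : ∀ m n : ℤ, m + 1 = n → ∀ V : Perf R, (Fin k → V.obj.X m) → (φ.C.obj V).X n)
    (nat : ∀ m n h (V V' : Perf R) (g : V ⟶ V') v,
      mapElt φ.C g n (ψ m n h V v) = ψ m n h V' fun a => (g.hom.f m).hom (v a))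
    (hd : ∀ l m n h h' (V : Perf R) v, ((φ.C.obj V).d n m).hom (ψ m n h V v) =
      -ψ l m h' V fun a => (V.obj.d m l).hom (v a))
    (h0 : ∀ m n h (V : Perf R) v a, (∀ b, b ≠ a → v b = 0) → ψ m n h V v = 0)
    (m n : ℤ) (h : m + 1 = n) (V : Perf R) (v : Fin k → V.obj.X m) : ψ m n h V v = 0 := by
  have hdisk : ∀ m n h (V : Perf R) v,
      ψ m n h V v = mapElt φ.C (diskHom v) n (ψ m n h _ (diskGen R k m)) := by
    intro m n h V v
    rw [nat]
    congr 1
    funext a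
    exact (diskHom_gen v a).symm
  have hzero : ∀ m n h (V : Perf R), (ψ m n h V fun _ => 0) = 0 := by
    intro m n h V
    rw [hdisk]
    exact mapElt_diskHom_zero φ.admissible.pointed (fun _ => rfl) _
  have hcyc : ∀ m n h (V : Perf R) (z : Fin k → V.obj.X m)
      (_ : ∀ a l, (V.obj.d m l).hom (z a) = 0), ψ m n h V z = 0 := by
    intro m n h V z hz
    -- Each idempotent kills all generators but one, so `h0` shows that it kills this value.
    have hs : ψ m n h (sphere R k m) (sphereGen R k m) = 0 := by
      refine sphere_injective h _ ?_ fun a => ?_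
      · rw [hd (m - 1) m n h (by omega)]
        simp only [sphere_d]
        rw [hzero, neg_zero]
      · rw [nat]
        refine h0 _ _ _ _ _ a fun b hb => ?_
        exact (sphereHom_gen _ (fun _ _ => sphere_d _) b).trans (if_neg hb)
    have := nat m n h _ _ (sphereHom z hz) (sphereGen R k m)
    rw [hs, map_zero] at this
    simp only [sphereHom_gen] at this
    exact this.symm
  rw [hdisk, show ψ m n h _ (diskGen R k m) = 0 from disk_injective h _ ?_, map_zero]
  rw [hd (m - 1) m n h (by omega), hcyc _ _ _ _ _ (fun _ _ => d_d_apply _ _ _ _ _), neg_zero]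

end ExtensionElements

end

end DGSplitting

namespace DGSplitting

noncomputable section

/-! ### Natural sections and the cocycles measuring their non-additivity. -/

section Sections

variable {R : Type u} [Ring R] {W : Type u} [AddCommGroup W] [Module Rᵐᵒᵖ W]

/-- A natural, not necessarily additive, section of `a` that is compatible with differentials. -/
structure NaturalSection (φ : ElementaryExtension R W) where
  /-- the section -/
  τ : ∀ (m : ℤ) (V : Perf R), V.obj.X m → (φ.C.obj V).X m
  natural : ∀ (m : ℤ) {V V' : Perf R} (g : V ⟶ V') (v : V.obj.X m),
    mapElt φ.C g m (τ m V v) = τ m V' ((g.hom.f m).hom v)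
  a_τ : ∀ (m : ℤ) (V : Perf R) (v : V.obj.X m), aElt φ V m (τ m V v) = v
  d_τ : ∀ (l m : ℤ), l + 1 = m → ∀ (V : Perf R) (v : V.obj.X m),
    ((φ.C.obj V).d m l).hom (τ m V v) = τ l V ((V.obj.d m l).hom v)

/-- A natural section of `a` whose failure to be additive is witnessed by a natural cocycle. -/
structure CocycleSection (φ : ElementaryExtension R W) extends NaturalSection φ where
  /-- the cocycle -/
  σ : ∀ (m n : ℤ), m + 1 = n → ∀ V : Perf R, V.obj.X m → V.obj.X m → (φ.C.obj V).X n
  σ_natural : ∀ (m n : ℤ) (h : m + 1 = n) {V V' : Perf R} (g : V ⟶ V') (v w : V.obj.X m),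
    mapElt φ.C g n (σ m n h V v w) = σ m n h V' ((g.hom.f m).hom v) ((g.hom.f m).hom w)
  a_σ : ∀ (m n : ℤ) (h : m + 1 = n) (V : Perf R) (v w : V.obj.X m),
    aElt φ V n (σ m n h V v w) = 0
  d_σ : ∀ (l m n : ℤ) (h : l + 1 = m) (h' : m + 1 = n) (V : Perf R) (v w : V.obj.X m),
    ((φ.C.obj V).d n m).hom (σ m n h' V v w) = τ m V v + τ m V w - τ m V (v + w) -
      σ l m h V ((V.obj.d m l).hom v) ((V.obj.d m l).hom w)
  σ_zero_right : ∀ (m n : ℤ) (h : m + 1 = n) (V : Perf R) (v : V.obj.X m), σ m n h V v 0 = 0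
  σ_symm : ∀ (m n : ℤ) (h : m + 1 = n) (V : Perf R) (v w : V.obj.X m),
    σ m n h V v w = σ m n h V w v
  σ_cocycle : ∀ (m n : ℤ) (h : m + 1 = n) (V : Perf R) (u v w : V.obj.X m),
    σ m n h V u v + σ m n h V (u + v) w = σ m n h V v w + σ m n h V u (v + w)

variable (φ : ElementaryExtension R W)

/-- The boundary of any lift lies in $\operatorname{Ker} a$, where it bounds because the sphere has
no term in degree $m-2$; subtracting a primitive makes the lift a cycle. -/
theorem exists_sphere_lift (m : ℤ) : ∃ y : (φ.C.obj (sphere R 1 m)).X m,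
    (∀ l, ((φ.C.obj (sphere R 1 m)).d m l).hom y = 0) ∧
      aElt φ _ m y = sphereGen R 1 m 0 := by
  obtain ⟨x, hx⟩ := aElt_surjective (φ := φ) _ m (sphereGen R 1 m 0)
  obtain ⟨y, hy, hyx⟩ := exists_d_eq (sub_add_cancel m 1) (sub_add_cancel (m - 1) 1)
    (isZero_sphere_X (R := R) (k := 1) (by omega)) (((φ.C.obj _).d m (m - 1)).hom x)
    (by rw [aElt_d, sphere_d]) (d_d_apply _ _ _ _ _)
  refine ⟨x - y, fun l => ?_, by rw [map_sub, hx, hy, sub_zero]⟩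
  by_cases hl : l + 1 = m
  · obtain rfl : l = m - 1 := by omega
    rw [map_sub, hyx, sub_self]
  · rw [(φ.C.obj _).shape _ _ hl]; rfl

variable {φ}

theorem exists_disk_d_eq {k : ℕ} {m i j : ℤ} (hi : j + 1 = i)
    (x : (φ.C.obj (disk R k m)).X j) (hx : ((φ.C.obj (disk R k m)).d j (j - 1)).hom x = 0) :
    ∃ y, ((φ.C.obj (disk R k m)).d i j).hom y = x :=
  (acyclic_iff _).1 (φ.admissible.acyclic _ (disk_acyclic m)) i j (j - 1) hi (by omega) x hx

theorem disk_d_injective {k : ℕ} {l m : ℤ} (h : l + 1 = m) :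
    Function.Injective ((disk R k m).obj.d m l).hom := by
  have := isIso_disk_d (R := R) (k := k) h
  exact (ModuleCat.mono_iff_injective _).1 inferInstance

/-- The element $t$ will be $\tau$ of the disk generator. Its boundary condition encodes $d\tau=\tau
d$, and its image in the sphere makes $\tau$ agree on cycles with the function defined by $y'$. -/
theorem exists_disk_lift {l m : ℤ} (h : l + 1 = m) (y : (φ.C.obj (sphere R 1 l)).X l)
    (y' : (φ.C.obj (sphere R 1 m)).X m) (hy : ∀ l', ((φ.C.obj (sphere R 1 l)).d l l').hom y = 0)
    (hy' : ∀ l', ((φ.C.obj (sphere R 1 m)).d m l').hom y' = 0)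
    (ha : aElt φ _ l y = sphereGen R 1 l 0) (ha' : aElt φ _ m y' = sphereGen R 1 m 0) :
    ∃ t : (φ.C.obj (disk R 1 m)).X m,
      ((φ.C.obj (disk R 1 m)).d m l).hom t = mapElt φ.C (sphereToDisk R 1 l m) l y ∧
      mapElt φ.C (diskToSphere R 1 m) m t = y' ∧ aElt φ _ m t = diskGen R 1 m 0 := by
  have hat : ∀ t, ((φ.C.obj (disk R 1 m)).d m l).hom t = mapElt φ.C (sphereToDisk R 1 l m) l y →
      aElt φ _ m t = diskGen R 1 m 0 := by
    intro t ht
    refine disk_d_injective h ?_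
    rw [← aElt_d, ht, aElt_mapElt, ha, sphereHom_gen]
  obtain ⟨t, ht⟩ := exists_disk_d_eq h (mapElt φ.C (sphereToDisk R 1 l m) l y)
    (by rw [d_mapElt, hy, map_zero])
  obtain ⟨z, -, hz⟩ := exists_d_eq (rfl : m + 1 = _) h (isZero_sphere_X (by omega))
    (y' - mapElt φ.C (diskToSphere R 1 m) m t)
    (by rw [map_sub, ha', aElt_mapElt, hat t ht, diskHom_gen, sub_self])
    (by rw [map_sub, hy', d_mapElt, ht, mapElt_comp,
      mapElt_zero (g := sphereToDisk R 1 l m ≫ diskToSphere R 1 m) φ.admissible.pointed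
        (sphereToDisk_diskToSphere h), sub_zero])
  -- Lifting the primitive $z$ to the disk allows $t$ to be corrected by a boundary, which leaves
  -- $dt$ unchanged.
  obtain ⟨z', rfl⟩ := ((quasiExact_iff _ _).1
    (φ.admissible.quasiExact _ _ _ (shortExact_disk h))).2.2.1 (m + 1) z
  change ((φ.C.obj _).d _ _).hom (mapElt φ.C (diskToSphere R 1 m) (m + 1) z') = _ at hz
  have ht' : ((φ.C.obj (disk R 1 m)).d m l).hom (t + ((φ.C.obj (disk R 1 m)).d (m + 1) m).hom z')
      = mapElt φ.C (sphereToDisk R 1 l m) l y := by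
    rw [map_add, ht, d_d_apply, add_zero]
  refine ⟨_, ht', ?_, hat _ ht'⟩
  rw [map_add, ← d_mapElt, hz, add_sub_cancel]

-- The chosen cycles on spheres are independent of each other, so every degree is solved separately
-- and no recursion over $\mathbb Z$ is needed.
variable (φ) in
theorem nonempty_naturalSection : Nonempty (NaturalSection φ) := by
  choose y hy ha using exists_sphere_lift φ
  choose t ht hty hta using fun l m (h : l + 1 = m) =>
    exists_disk_lift h (y l) (y m) (hy l) (hy m) (ha l) (ha m)
  replace ht : ∀ l m (h : l + 1 = m), ((φ.C.obj (disk R 1 m)).d m l).hom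
      (t (m - 1) m (sub_add_cancel m 1)) = mapElt φ.C (sphereToDisk R 1 l m) l (y l) := by
    intro l m h
    obtain rfl : l = m - 1 := by omega
    exact ht _ _ _
  refine ⟨⟨fun m V v => mapElt φ.C (diskHom fun _ => v) m (t (m - 1) m (sub_add_cancel m 1)),
    ?_, ?_, ?_⟩⟩
  · intro m V V' g v
    rw [mapElt_comp, diskHom_comp]
  · intro m V v
    rw [aElt_mapElt, hta, diskHom_gen]
  · intro l m h V v
    rw [d_mapElt, ht _ _ h, mapElt_comp, sphereHom_comp]
    -- The classifying map of a cycle factors through the sphere, so $\tau(dv)$ is computed from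
    -- $y_l$.
    have : ∀ hz, (diskHom fun _ => (V.obj.d m l).hom v) =
        diskToSphere R 1 l ≫ sphereHom (fun _ => (V.obj.d m l).hom v) hz := by
      intro hz
      rw [diskHom_comp]
      congr 1
      funext a
      rw [sphereHom_gen]
    rw [this fun _ _ => d_d_apply _ _ _ _ _, ← mapElt_comp, hty]
    congr 2
    congr 1
    funext a
    rw [← hom_d_comm, diskHom_gen]

namespace NaturalSection

variable (s : NaturalSection φ)

theorem τ_zero (m : ℤ) (V : Perf R) : s.τ m V 0 = 0 := by
  rw [← diskHom_gen (fun _ : Fin 1 => (0 : V.obj.X m)) 0, ← s.natural,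
    mapElt_diskHom_zero φ.admissible.pointed (fun _ => rfl)]

/-- The failure of `τ` to be additive. -/
def defect (m : ℤ) (V : Perf R) (v w : V.obj.X m) : (φ.C.obj V).X m :=
  s.τ m V v + s.τ m V w - s.τ m V (v + w)

theorem defect_natural (m : ℤ) {V V' : Perf R} (g : V ⟶ V') (v w : V.obj.X m) :
    mapElt φ.C g m (s.defect m V v w) =
      s.defect m V' ((g.hom.f m).hom v) ((g.hom.f m).hom w) := by
  simp only [defect, map_sub, map_add, s.natural]

theorem a_defect (m : ℤ) (V : Perf R) (v w : V.obj.X m) :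
    aElt φ V m (s.defect m V v w) = 0 := by
  simp only [defect, map_sub, map_add, s.a_τ, sub_self]

theorem d_defect {l m : ℤ} (h : l + 1 = m) (V : Perf R) (v w : V.obj.X m) :
    ((φ.C.obj V).d m l).hom (s.defect m V v w) =
      s.defect l V ((V.obj.d m l).hom v) ((V.obj.d m l).hom w) := by
  simp only [defect, map_sub, map_add, s.d_τ l m h]

theorem defect_zero_right (m : ℤ) (V : Perf R) (v : V.obj.X m) : s.defect m V v 0 = 0 := by
  simp [defect, τ_zero]

theorem defect_zero_left (m : ℤ) (V : Perf R) (v : V.obj.X m) : s.defect m V 0 v = 0 := by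
  simp [defect, τ_zero]

/-- The defect of the two generators bounds inside $\operatorname{Ker} a$. The last condition
normalizes the primitive: it makes $\sigma$ vanish on cycles when one argument is zero. -/
theorem exists_sphere_cocycle (m n : ℤ) (h : m + 1 = n) :
    ∃ y : (φ.C.obj (sphere R 2 m)).X n, aElt φ _ n y = 0 ∧
      ((φ.C.obj (sphere R 2 m)).d n m).hom y =
        s.defect m _ (sphereGen R 2 m 0) (sphereGen R 2 m 1) ∧
      ∀ a, mapElt φ.C (sphereIdem R 2 m a) n y = 0 := by
  obtain ⟨y, hy, hyd⟩ := exists_d_eq h (sub_add_cancel m 1) (isZero_sphere_X (by omega))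
    (s.defect m _ (sphereGen R 2 m 0) (sphereGen R 2 m 1)) (s.a_defect _ _ _ _)
    (by rw [s.d_defect (by omega), sphere_d, sphere_d, s.defect_zero_right])
  -- The idempotents are orthogonal, and pointedness preserves this.
  have hc : ∀ a b, mapElt φ.C (sphereIdem R 2 m a) n (mapElt φ.C (sphereIdem R 2 m b) n y) =
      if a = b then mapElt φ.C (sphereIdem R 2 m b) n y else 0 := by
    intro a b
    rw [mapElt_comp]
    split_ifs with hab
    · subst hab
      congr 2
      refine sphere_hom_ext fun c => ?_
      rw [sphereIdem, sphereHom_comp, sphereHom_gen, sphereHom_gen]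
      split_ifs with hc
      · rw [sphereHom_gen, if_pos hc]
      · rw [map_zero]
    · refine mapElt_zero φ.admissible.pointed (congrArg InducedCategory.Hom.hom
        (sphere_hom_ext (g := ⟨0⟩) fun c => ?_)) n y
      rw [sphereIdem, sphereIdem, sphereHom_comp, sphereHom_gen]
      split_ifs with hc
      · rw [sphereHom_gen, if_neg (by rw [hc]; exact fun h => hab h.symm)]; rfl
      · rw [map_zero]; rfl
  -- The subtracted terms have boundaries $\mathrm{defect}(e_0,0)$ and $\mathrm{defect}(0,e_1)$,
  -- which are zero.
  refine ⟨y - mapElt φ.C (sphereIdem R 2 m 0) n y - mapElt φ.C (sphereIdem R 2 m 1) n y,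
    ?_, ?_, fun a => ?_⟩
  · rw [map_sub, map_sub, aElt_mapElt, aElt_mapElt, hy, map_zero, map_zero, sub_zero, sub_zero]
  · rw [map_sub, map_sub, d_mapElt, d_mapElt, hyd, s.defect_natural, s.defect_natural,
      sphereIdem, sphereIdem, sphereHom_gen, sphereHom_gen, sphereHom_gen, sphereHom_gen,
      if_neg (show ¬(1 : Fin 2) = 0 by decide), if_neg (show ¬(0 : Fin 2) = 1 by decide),
      s.defect_zero_left, s.defect_zero_right, sub_zero, sub_zero]
  · rw [map_sub, map_sub, hc, hc]
    fin_cases a <;> simp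

end NaturalSection

theorem comp_pair {A B : Type*} (f : A → B) (v w : A) :
    (fun a : Fin 2 => f (![v, w] a)) = ![f v, f w] := by
  funext a
  fin_cases a <;> rfl

namespace NaturalSection

variable (s : NaturalSection φ)

/-- The function is first defined on cycles (`σ'`), then on all elements through the disk with `σ'`
in the boundary formula. The two agree on cycles by rigidity, which closes the formula. -/
theorem exists_disk_cocycle : ∃ σ : ∀ (m n : ℤ), m + 1 = n → ∀ V : Perf R,
    V.obj.X m → V.obj.X m → (φ.C.obj V).X n,
    (∀ (m n : ℤ) (h : m + 1 = n) {V V' : Perf R} (g : V ⟶ V') (v w : V.obj.X m),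
      mapElt φ.C g n (σ m n h V v w) =
        σ m n h V' ((g.hom.f m).hom v) ((g.hom.f m).hom w)) ∧
    (∀ (m n : ℤ) (h : m + 1 = n) (V : Perf R) (v w : V.obj.X m),
      aElt φ V n (σ m n h V v w) = 0) ∧
    (∀ (l m n : ℤ) (h : l + 1 = m) (h' : m + 1 = n) (V : Perf R) (v w : V.obj.X m),
      ((φ.C.obj V).d n m).hom (σ m n h' V v w) = s.defect m V v w -
        σ l m h V ((V.obj.d m l).hom v) ((V.obj.d m l).hom w)) ∧
    (∀ (m n : ℤ) (h : m + 1 = n) (V : Perf R) (v : V.obj.X m), σ m n h V v 0 = 0) ∧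
    ∀ (m n : ℤ) (h : m + 1 = n) (V : Perf R) (v : V.obj.X m), σ m n h V 0 v = 0 := by
  choose y hay hdy hy using s.exists_sphere_cocycle
  have hp {V : Perf R} {m : ℤ} {z w : V.obj.X m} (hz : ∀ l, (V.obj.d m l).hom z = 0)
      (hw : ∀ l, (V.obj.d m l).hom w = 0) :
      ∀ a l, (V.obj.d m l).hom ((![z, w] : Fin 2 → V.obj.X m) a) = 0 := by
    intro a l
    fin_cases a
    exacts [hz l, hw l]
  have hdd {V : Perf R} (m l : ℤ) (v : V.obj.X m) (l' : ℤ) :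
      (V.obj.d l l').hom ((V.obj.d m l).hom v) = 0 := d_d_apply _ _ _ _ _
  -- the cocycle on cycles
  let σ' (m n : ℤ) (h : m + 1 = n) (V : Perf R) (z w : V.obj.X m)
    (hz : ∀ l, (V.obj.d m l).hom z = 0) (hw : ∀ l, (V.obj.d m l).hom w = 0) :
    (φ.C.obj V).X n := mapElt φ.C (sphereHom ![z, w] (hp hz hw)) n (y m n h)
  have σ'_natural (m n : ℤ) (h : m + 1 = n) {V V' : Perf R} (g : V ⟶ V') (z w : V.obj.X m) hz hw
      (z' w' : V'.obj.X m) hz' hw' (hzz : (g.hom.f m).hom z = z') (hww : (g.hom.f m).hom w = w') :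
      mapElt φ.C g n (σ' m n h V z w hz hw) = σ' m n h V' z' w' hz' hw' := by
    subst hzz hww
    simp only [σ', mapElt_comp, sphereHom_comp, comp_pair]
  have d_σ' (m n : ℤ) (h : m + 1 = n) (V : Perf R) (z w : V.obj.X m) hz hw :
      ((φ.C.obj V).d n m).hom (σ' m n h V z w hz hw) = s.defect m V z w := by
    simp only [σ', d_mapElt, hdy, s.defect_natural, sphereHom_gen]
    rfl
  have σ'_zero_right (m n : ℤ) (h : m + 1 = n) (V : Perf R) (z w : V.obj.X m) hz hw (h0 : w = 0) :
      σ' m n h V z w hz hw = 0 := by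
    subst h0
    have : sphereHom ![z, 0] (hp hz hw) = sphereIdem R 2 m 0 ≫ sphereHom ![z, 0] (hp hz hw) := by
      rw [sphereIdem, sphereHom_comp]
      congr 1
      funext a
      fin_cases a
      · exact (sphereHom_gen _ (hp hz hw) 0).symm
      · exact (map_zero _).symm
    simp only [σ']
    rw [this, ← mapElt_comp, hy, map_zero]
  have σ'_zero_left (m n : ℤ) (h : m + 1 = n) (V : Perf R) (z w : V.obj.X m) hz hw (h0 : z = 0) :
      σ' m n h V z w hz hw = 0 := by
    subst h0
    have : sphereHom ![0, w] (hp hz hw) = sphereIdem R 2 m 1 ≫ sphereHom ![0, w] (hp hz hw) := by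
      rw [sphereIdem, sphereHom_comp]
      congr 1
      funext a
      fin_cases a
      · exact (map_zero _).symm
      · exact (sphereHom_gen _ (hp hz hw) 1).symm
    simp only [σ']
    rw [this, ← mapElt_comp, hy, map_zero]
  have ht : ∀ l m n : ℤ, ∀ (h : l + 1 = m) (h' : m + 1 = n),
      ∃ t : (φ.C.obj (disk R 2 m)).X n, ((φ.C.obj (disk R 2 m)).d n m).hom t =
        s.defect m _ (diskGen R 2 m 0) (diskGen R 2 m 1) -
          σ' l m h (disk R 2 m) _ _ (hdd m l (diskGen R 2 m 0)) (hdd m l (diskGen R 2 m 1)) := by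
    intro l m n h h'
    obtain rfl : l = m - 1 := by omega
    -- Both terms have boundary $\mathrm{defect}(dv,dw)$, so their difference is a cycle in an
    -- acyclic complex.
    refine exists_disk_d_eq h' _ ?_
    rw [map_sub, s.d_defect h, d_σ', sub_self] <;> exact hdd _ _ _
  choose t ht using ht
  let σ (m n : ℤ) (h : m + 1 = n) (V : Perf R) (v w : V.obj.X m) : (φ.C.obj V).X n :=
    mapElt φ.C (diskHom ![v, w]) n (t (m - 1) m n (sub_add_cancel m 1) h)
  have nat (m n : ℤ) (h : m + 1 = n) {V V' : Perf R} (g : V ⟶ V') (v w : V.obj.X m) :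
      mapElt φ.C g n (σ m n h V v w) = σ m n h V' ((g.hom.f m).hom v) ((g.hom.f m).hom w) := by
    simp only [σ, mapElt_comp, diskHom_comp, comp_pair]
  have hd (l m n : ℤ) (h : l + 1 = m) (h' : m + 1 = n) (V : Perf R) (v w : V.obj.X m) :
      ((φ.C.obj V).d n m).hom (σ m n h' V v w) =
        s.defect m V v w - σ' l m h V _ _ (hdd m l v) (hdd m l w) := by
    obtain rfl : l = m - 1 := by omega
    simp only [σ]
    rw [d_mapElt, ht, map_sub, s.defect_natural, diskHom_gen, diskHom_gen]
    congr 1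
    refine σ'_natural _ _ _ _ _ _ (hdd _ _ _) (hdd _ _ _) _ _ (hdd _ _ _) (hdd _ _ _) ?_ ?_ <;>
      rw [← hom_d_comm, diskHom_gen] <;> rfl
  have zero_right (m n : ℤ) (h : m + 1 = n) (V : Perf R) (v : V.obj.X m) :
      σ m n h V v 0 = 0 := by
    have : σ m n h (disk R 1 m) (diskGen R 1 m 0) 0 = 0 := by
      refine disk_injective h _ ?_
      rw [hd (m - 1) m n (by omega), s.defect_zero_right, σ'_zero_right _ _ _ _ _ _ _ _
        (map_zero _), sub_zero] <;> exact hdd _ _ _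
    have h' := nat m n h (diskHom fun _ => v) (diskGen R 1 m 0) 0
    rw [this, map_zero, map_zero, diskHom_gen] at h'
    exact h'.symm
  have zero_left (m n : ℤ) (h : m + 1 = n) (V : Perf R) (v : V.obj.X m) :
      σ m n h V 0 v = 0 := by
    have : σ m n h (disk R 1 m) 0 (diskGen R 1 m 0) = 0 := by
      refine disk_injective h _ ?_
      rw [hd (m - 1) m n (by omega), s.defect_zero_left, σ'_zero_left _ _ _ _ _ _ _ _
        (map_zero _), sub_zero] <;> exact hdd _ _ _
    have h' := nat m n h (diskHom fun _ => v) 0 (diskGen R 1 m 0)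
    rw [this, map_zero, map_zero, diskHom_gen] at h'
    exact h'.symm
  have hσ (m n : ℤ) (h : m + 1 = n) (V : Perf R) (z w : V.obj.X m) hz hw :
      σ m n h V z w = σ' m n h V z w hz hw := by
    -- Both have the defect as boundary, and both are killed by the idempotents.
    have : σ m n h (sphere R 2 m) (sphereGen R 2 m 0) (sphereGen R 2 m 1) - y m n h = 0 := by
      refine sphere_injective h _ ?_ fun a => ?_
      · rw [map_sub, hd (m - 1) m n (by omega), hdy, σ'_zero_right _ _ _ _ _ _ _ _ (sphere_d _),
          sub_zero, sub_self] <;> exact hdd _ _ _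
      · rw [map_sub, hy, sub_zero, nat, sphereIdem, sphereHom_gen, sphereHom_gen]
        fin_cases a
        · exact zero_right _ _ _ _ _
        · exact zero_left _ _ _ _ _
    have h' := nat m n h (sphereHom ![z, w] (hp hz hw)) (sphereGen R 2 m 0) (sphereGen R 2 m 1)
    rw [sub_eq_zero.1 this, sphereHom_gen, sphereHom_gen] at h'
    exact h'.symm
  refine ⟨σ, fun m n h _ _ => nat m n h, fun m n h V v w => ?_, fun l m n h h' V v w => ?_,
    zero_right, zero_left⟩
  · have : Subsingleton ((disk R 2 m).obj.X n) :=
      ModuleCat.subsingleton_of_isZero (concentratedLE_disk m n (by omega))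
    simp only [σ]
    rw [aElt_mapElt, Subsingleton.elim (aElt φ (disk R 2 m) n _) 0, map_zero]
  · rw [hd l m n h, hσ] <;> exact hdd _ _ _

-- Symmetry and the cocycle identity hold for the defect of any function. The corresponding
-- combinations of $\sigma$ thus satisfy $d\psi(v)=-\psi(dv)$ and vanish by rigidity.
variable (φ) in
theorem _root_.DGSplitting.nonempty_cocycleSection : Nonempty (CocycleSection φ) := by
  obtain ⟨s⟩ := nonempty_naturalSection φ
  obtain ⟨σ, nat, ha, hd, zero_right, zero_left⟩ := s.exists_disk_cocycle
  refine ⟨⟨s, σ, nat, ha, hd, zero_right, fun m n h V v w => ?_, fun m n h V u v w => ?_⟩⟩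
  · refine sub_eq_zero.1 (eq_zero_of_natural (k := 2)
      (fun m n h V v => σ m n h V (v 0) (v 1) - σ m n h V (v 1) (v 0)) ?_ ?_ ?_ m n h V ![v, w])
    · intro m n h V V' g v
      simp only [map_sub, nat]
    · intro l m n h h' V v
      simp only [map_sub, hd l m n h', defect, add_comm (v 0)]
      abel
    · intro m n h V v a hv
      fin_cases a
      · rw [hv 1 (by decide), zero_left, zero_right, sub_self]
      · rw [hv 0 (by decide), zero_left, zero_right, sub_self]
  · refine sub_eq_zero.1 (eq_zero_of_natural (k := 3)
      (fun m n h V v => σ m n h V (v 0) (v 1) + σ m n h V (v 0 + v 1) (v 2) -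
        (σ m n h V (v 1) (v 2) + σ m n h V (v 0) (v 1 + v 2))) ?_ ?_ ?_ m n h V ![u, v, w])
    · intro m n h V V' g v
      simp only [map_sub, map_add, nat]
    · intro l m n h h' V v
      simp only [map_sub, map_add, hd l m n h', defect, add_assoc (v 0)]
      abel
    · intro m n h V v a hv
      fin_cases a
      · rw [hv 1 (by decide), hv 2 (by decide)]
        simp [zero_right]
      · rw [hv 0 (by decide), hv 2 (by decide)]
        simp [zero_right, zero_left]
      · rw [hv 0 (by decide), hv 1 (by decide)]
        simp [zero_left]

end NaturalSection

end Sections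

end

end DGSplitting

namespace DGSplitting

noncomputable section

/-! ### Coordinates on the cone. -/

section ConeElements

variable {R : Type u} [Ring R]

theorem down_rel_sub_one (i : ℤ) : (ComplexShape.down ℤ).Rel i (i - 1) := sub_add_cancel i 1

/-- The inclusion of the shifted complex into the cone, on elements. -/
def coneInl (V : Perf R) (i : ℤ) : V.obj.X (i - 1) →+ ((conePerf R).obj V).X i :=
  (HomologicalComplex.homotopyCofiber.inlX (𝟙 ((forgetPerf R).obj V)) (i - 1) i
    (down_rel_sub_one i)).hom.toAddMonoidHom

/-- The inclusion of a complex into its cone, on elements. -/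
def coneInr (V : Perf R) (i : ℤ) : V.obj.X i →+ ((conePerf R).obj V).X i :=
  (HomologicalComplex.homotopyCofiber.inrX (𝟙 ((forgetPerf R).obj V)) i).hom.toAddMonoidHom

theorem d_coneInl {V : Perf R} (i : ℤ) (v : V.obj.X (i - 1)) :
    (((conePerf R).obj V).d i (i - 1)).hom (coneInl V i v) =
      coneInr V (i - 1) v - coneInl V (i - 1) ((V.obj.d (i - 1) (i - 1 - 1)).hom v) := by
  have h := congrArg (fun f => f.hom v)
    (HomologicalComplex.homotopyCofiber.inlX_d (𝟙 ((forgetPerf R).obj V)) i (i - 1) (i - 1 - 1)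
      (down_rel_sub_one _) (down_rel_sub_one _))
  exact h.trans (neg_add_eq_sub _ _)

theorem map_coneInl {V V' : Perf R} (g : V ⟶ V') (i : ℤ) (v : V.obj.X (i - 1)) :
    mapElt (conePerf R) g i (coneInl V i v) = coneInl V' i ((g.hom.f (i - 1)).hom v) := by
  have h : HomologicalComplex.homotopyCofiber.inlX (𝟙 ((forgetPerf R).obj V)) (i - 1) i
      (down_rel_sub_one i) ≫ ((conePerf R).map g).f i = ((forgetPerf R).map g).f (i - 1) ≫
      HomologicalComplex.homotopyCofiber.inlX (𝟙 ((forgetPerf R).obj V')) (i - 1) i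
        (down_rel_sub_one i) := by
    refine (HomologicalComplex.homotopyCofiber.inlX_desc_f _ _ _ _ _ _).trans ?_
    simp [HomologicalComplex.homotopyCofiber.inrCompHomotopy_hom _ _ _ _ (down_rel_sub_one i)]
    rfl
  exact congrArg (fun f => f.hom v) h

theorem exists_cone_eq {V : Perf R} {i : ℤ} (y : ((conePerf R).obj V).X i) :
    ∃ v w, y = coneInl V i v + coneInr V i w := by
  let f := 𝟙 ((forgetPerf R).obj V)
  have h : HomologicalComplex.homotopyCofiber.fstX f i (i - 1) (down_rel_sub_one i) ≫
      HomologicalComplex.homotopyCofiber.inlX f (i - 1) i (down_rel_sub_one i) +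
      HomologicalComplex.homotopyCofiber.sndX f i ≫
        HomologicalComplex.homotopyCofiber.inrX f i = 𝟙 _ :=
    HomologicalComplex.homotopyCofiber.ext_to_X f i (i - 1) (down_rel_sub_one i)
      (by simp) (by simp)
  exact ⟨_, _, (congrArg (fun f => f.hom y) h).symm⟩

theorem cone_eq_zero {V : Perf R} {i : ℤ} {v : V.obj.X (i - 1)} {w : V.obj.X i}
    (h : coneInl V i v + coneInr V i w = 0) : v = 0 ∧ w = 0 := by
  let f := 𝟙 ((forgetPerf R).obj V)
  let p : ((conePerf R).obj V).X i →+ V.obj.X (i - 1) :=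
    (HomologicalComplex.homotopyCofiber.fstX f i (i - 1) (down_rel_sub_one i)).hom.toAddMonoidHom
  let q : ((conePerf R).obj V).X i →+ V.obj.X i :=
    (HomologicalComplex.homotopyCofiber.sndX f i).hom.toAddMonoidHom
  have h₁ (v' : V.obj.X (i - 1)) : p (coneInl V i v') = v' := congrArg (fun f => f.hom v')
    (HomologicalComplex.homotopyCofiber.inlX_fstX f (i - 1) i (down_rel_sub_one i))
  have h₂ (w' : V.obj.X i) : p (coneInr V i w') = 0 := congrArg (fun f => f.hom w')
    (HomologicalComplex.homotopyCofiber.inrX_fstX f i (i - 1) (down_rel_sub_one i))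
  have h₃ (w' : V.obj.X i) : q (coneInr V i w') = w' :=
    congrArg (fun f => f.hom w') (HomologicalComplex.homotopyCofiber.inrX_sndX f i)
  have hv : v = 0 := by
    have := congrArg p h
    rwa [map_add, map_zero, h₁, h₂, add_zero] at this
  subst hv
  refine ⟨rfl, ?_⟩
  have := congrArg q h
  rwa [map_zero, zero_add, map_zero, h₃] at this

theorem coneInr_injective (V : Perf R) (i : ℤ) : Function.Injective (coneInr V i) := by
  rw [injective_iff_map_eq_zero]
  intro w hw
  exact (cone_eq_zero (v := 0) (by rw [hw, map_zero, zero_add])).2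

end ConeElements

/-! ### Abelian group extensions from symmetric cocycles. -/

section CocycleExtension

variable (A B : Type*) [AddCommGroup A] [AddCommGroup B]

/-- Normalized symmetric two-cocycles. -/
structure SymmCocycle where
  /-- the underlying function -/
  toFun : B → B → A
  zero_right : ∀ v, toFun v 0 = 0
  symm : ∀ v w, toFun v w = toFun w v
  cocycle : ∀ u v w, toFun u v + toFun (u + v) w = toFun v w + toFun u (v + w)

variable {A B}

/-- The abelian extension defined by a symmetric cocycle. -/
@[ext]
structure SymmCocycle.Extension (c : SymmCocycle A B) where
  /-- the component in the subgroup -/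
  fst : A
  /-- the component in the quotient -/
  snd : B

namespace SymmCocycle.Extension

variable {c : SymmCocycle A B}

instance : Add c.Extension := ⟨fun x y => ⟨x.fst + y.fst + c.toFun x.snd y.snd, x.snd + y.snd⟩⟩

instance : Zero c.Extension := ⟨⟨0, 0⟩⟩

instance : Neg c.Extension := ⟨fun x => ⟨-x.fst - c.toFun x.snd (-x.snd), -x.snd⟩⟩

instance : AddCommGroup c.Extension where
  nsmul := nsmulRec
  zsmul := zsmulRec
  add_assoc x y z := Extension.ext (by
    have := c.cocycle x.snd y.snd z.snd
    change x.fst + y.fst + c.toFun x.snd y.snd + z.fst + c.toFun (x.snd + y.snd) z.snd =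
      x.fst + (y.fst + z.fst + c.toFun y.snd z.snd) + c.toFun x.snd (y.snd + z.snd)
    rw [eq_sub_of_add_eq this]
    abel) (add_assoc _ _ _)
  zero_add x := Extension.ext (by
    change 0 + x.fst + c.toFun 0 x.snd = x.fst
    rw [c.symm, c.zero_right, zero_add, add_zero]) (zero_add _)
  add_zero x := Extension.ext (by
    change x.fst + 0 + c.toFun x.snd 0 = x.fst
    rw [c.zero_right, add_zero, add_zero]) (add_zero _)
  neg_add_cancel x := Extension.ext (by
    change -x.fst - c.toFun x.snd (-x.snd) + x.fst + c.toFun (-x.snd) x.snd = 0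
    rw [c.symm (-x.snd)]
    abel) (neg_add_cancel _)
  add_comm x y := Extension.ext (by
    change x.fst + y.fst + c.toFun x.snd y.snd = y.fst + x.fst + c.toFun y.snd x.snd
    rw [c.symm, add_comm x.fst]) (add_comm _ _)

theorem add_def (x y : c.Extension) :
    x + y = ⟨x.fst + y.fst + c.toFun x.snd y.snd, x.snd + y.snd⟩ := rfl

variable (c) in
/-- The inclusion of the subgroup. -/
def incl : A →+ c.Extension where
  toFun x := ⟨x, 0⟩
  map_zero' := rfl
  map_add' x y := Extension.ext (by
    change x + y = x + y + c.toFun 0 0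
    rw [c.zero_right, add_zero]) (add_zero _).symm

variable (c) in
/-- The set-theoretic section of the quotient map. -/
def sec (v : B) : c.Extension := ⟨0, v⟩

theorem sec_zero : sec c 0 = 0 := rfl

theorem eq_incl_add_sec (x : c.Extension) : x = incl c x.fst + sec c x.snd :=
  Extension.ext (by
    change x.fst = x.fst + 0 + c.toFun 0 x.snd
    rw [c.symm, c.zero_right, add_zero, add_zero]) (zero_add _).symm

theorem sec_add_sec (v w : B) :
    sec c v + sec c w = sec c (v + w) + incl c (c.toFun v w) :=
  Extension.ext (by
    change 0 + 0 + c.toFun v w = 0 + c.toFun v w + c.toFun (v + w) 0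
    rw [c.zero_right, zero_add, zero_add, add_zero]) (add_zero _).symm

/-- Homomorphisms out of the extension. -/
def lift {G : Type*} [AddCommGroup G] (f : A →+ G) (g : B → G)
    (h : ∀ v w, g v + g w = g (v + w) + f (c.toFun v w)) : c.Extension →+ G where
  toFun x := f x.fst + g x.snd
  map_zero' := by
    have := h 0 0
    rw [c.zero_right, map_zero, add_zero, add_zero, add_eq_right] at this
    change f 0 + g 0 = 0
    rw [map_zero, this, zero_add]
  map_add' x y := by
    rw [add_def]
    change f (x.fst + y.fst + c.toFun x.snd y.snd) + g (x.snd + y.snd) =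
      f x.fst + g x.snd + (f y.fst + g y.snd)
    rw [add_add_add_comm (f x.fst), h, map_add, map_add]
    abel

theorem lift_incl {G : Type*} [AddCommGroup G] (f : A →+ G) (g : B → G)
    (h : ∀ v w, g v + g w = g (v + w) + f (c.toFun v w)) (x : A) : lift f g h (incl c x) = f x := by
  have := h 0 0
  rw [c.zero_right, map_zero, add_zero, add_zero, add_eq_right] at this
  change f x + g 0 = f x
  rw [this, add_zero]

theorem lift_sec {G : Type*} [AddCommGroup G] (f : A →+ G) (g : B → G)
    (h : ∀ v w, g v + g w = g (v + w) + f (c.toFun v w)) (v : B) : lift f g h (sec c v) = g v := by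
  change f 0 + g v = g v
  rw [map_zero, zero_add]

theorem hom_ext {G : Type*} [AddCommGroup G] {f g : c.Extension →+ G}
    (h₁ : ∀ x, f (incl c x) = g (incl c x)) (h₂ : ∀ v, f (sec c v) = g (sec c v)) : f = g := by
  ext x
  rw [eq_incl_add_sec x, map_add, map_add, h₁, h₂]

end SymmCocycle.Extension

end CocycleExtension

end

end DGSplitting

namespace DGSplitting

noncomputable section

/-- An additive map as a `ℤ`-linear map, for arbitrary `ℤ`-module structures. -/
def intLinear {A B : Type*} [AddCommGroup A] [AddCommGroup B] [Module ℤ A] [Module ℤ B]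
    (f : A →+ B) : A →ₗ[ℤ] B where
  toFun := f
  map_add' := f.map_add
  map_smul' c x := by simpa using map_intCast_smul f ℤ ℤ c x

/-! ### The functor $C^r$ and its maps. -/

namespace CocycleSection

open SymmCocycle.Extension

variable {R : Type u} [Ring R] {W : Type u} [AddCommGroup W] [Module Rᵐᵒᵖ W]
  {φ : ElementaryExtension R W} (s : CocycleSection φ)

/-- The cocycle in degree `i`. -/
def cocycle (V : Perf R) (i : ℤ) : SymmCocycle ((φ.C.obj V).X i) (V.obj.X (i - 1)) where
  toFun := s.σ (i - 1) i (sub_add_cancel i 1) V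
  zero_right := s.σ_zero_right _ _ _ _
  symm := s.σ_symm _ _ _ _
  cocycle := s.σ_cocycle _ _ _ _

/-- The differential of the extension of the shifted complex. -/
def extD (V : Perf R) (i : ℤ) : (s.cocycle V i).Extension →+ (s.cocycle V (i - 1)).Extension :=
  lift ((incl (s.cocycle V (i - 1))).comp ((φ.C.obj V).d i (i - 1)).hom.toAddMonoidHom)
    -- The differential of the cone, with $\tau v$ lifting $v$. Its compatibility with the twisted
    -- addition is exactly the formula for $d\sigma$.
    (fun v => incl _ (s.τ (i - 1) V v) - sec _ ((V.obj.d (i - 1) (i - 1 - 1)).hom v)) (by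
      intro v w
      have h : ((φ.C.obj V).d i (i - 1)).hom ((s.cocycle V i).toFun v w) = _ :=
        s.d_σ (i - 1 - 1) (i - 1) i (sub_add_cancel _ 1) (sub_add_cancel _ 1) V v w
      have h' := sec_add_sec (c := s.cocycle V (i - 1)) ((V.obj.d (i - 1) (i - 1 - 1)).hom v)
        ((V.obj.d (i - 1) (i - 1 - 1)).hom w)
      change _ = _ + incl _ (((φ.C.obj V).d i (i - 1)).hom ((s.cocycle V i).toFun v w))
      rw [h, map_sub, map_sub, map_add, map_add, sub_add_sub_comm, h']
      change _ = _ + (_ - incl _ ((s.cocycle V (i - 1)).toFun _ _))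
      abel)

theorem extD_incl (V : Perf R) (i : ℤ) (x : (φ.C.obj V).X i) :
    s.extD V i (incl _ x) = incl _ (((φ.C.obj V).d i (i - 1)).hom x) :=
  lift_incl _ _ _ _

theorem extD_sec (V : Perf R) (i : ℤ) (v : V.obj.X (i - 1)) : s.extD V i (sec _ v) =
    incl _ (s.τ (i - 1) V v) - sec _ ((V.obj.d (i - 1) (i - 1 - 1)).hom v) :=
  lift_sec _ _ _ _

theorem extD_extD (V : Perf R) (i : ℤ) (x : (s.cocycle V i).Extension) :
    s.extD V (i - 1) (s.extD V i x) = 0 := by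
  rw [eq_incl_add_sec x, map_add, map_add, extD_incl, extD_incl, extD_sec, map_sub, extD_incl,
    extD_sec, d_d_apply, d_d_apply, s.d_τ _ _ (sub_add_cancel _ 1), sec_zero]
  simp

/-- The action of a morphism on the extension of the shifted complex. -/
def extMap {V V' : Perf R} (g : V ⟶ V') (i : ℤ) :
    (s.cocycle V i).Extension →+ (s.cocycle V' i).Extension :=
  lift ((incl _).comp (mapElt φ.C g i).toAddMonoidHom)
    (fun v => sec _ ((g.hom.f (i - 1)).hom v)) (by
      intro v w
      have h : mapElt φ.C g i ((s.cocycle V i).toFun v w) = _ := s.σ_natural _ _ _ g v w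
      change _ = _ + incl _ (mapElt φ.C g i ((s.cocycle V i).toFun v w))
      rw [h, sec_add_sec, map_add]
      rfl)

theorem extMap_incl {V V' : Perf R} (g : V ⟶ V') (i : ℤ) (x : (φ.C.obj V).X i) :
    s.extMap g i (incl _ x) = incl _ (mapElt φ.C g i x) := lift_incl _ _ _ _

theorem extMap_sec {V V' : Perf R} (g : V ⟶ V') (i : ℤ) (v : V.obj.X (i - 1)) :
    s.extMap g i (sec _ v) = sec _ ((g.hom.f (i - 1)).hom v) := lift_sec _ _ _ _

theorem extD_extMap {V V' : Perf R} (g : V ⟶ V') (i : ℤ) (x : (s.cocycle V i).Extension) :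
    s.extD V' i (s.extMap g i x) = s.extMap g (i - 1) (s.extD V i x) := by
  rw [eq_incl_add_sec x]
  simp only [map_add, map_sub, extD_incl, extD_sec, extMap_incl, extMap_sec, d_mapElt,
    s.natural, hom_d_comm]

/-- The extension of the shifted complex by `C`. -/
def complex (V : Perf R) : ChainComplex (ModuleCat.{u} ℤ) ℤ where
  X i := ModuleCat.of ℤ (s.cocycle V i).Extension
  d i j := if h : i - 1 = j then
    ModuleCat.ofHom (intLinear (s.extD V i)) ≫ eqToHom (by rw [h]) else 0
  shape i j h := dif_neg fun h' => h (by subst h'; exact sub_add_cancel i 1)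
  d_comp_d' i j k hij hjk := by
    obtain rfl : j = i - 1 := eq_sub_of_add_eq hij
    obtain rfl : k = i - 1 - 1 := eq_sub_of_add_eq hjk
    rw [dif_pos rfl, dif_pos rfl, eqToHom_refl, eqToHom_refl, Category.comp_id, Category.comp_id]
    exact ModuleCat.hom_ext (LinearMap.ext fun x => s.extD_extD V i x)

theorem complex_d (V : Perf R) (i : ℤ) :
    (s.complex V).d i (i - 1) = ModuleCat.ofHom (intLinear (s.extD V i)) :=
  (dif_pos rfl).trans (Category.comp_id _)

/-- The functor `C^r`. -/
def functor : Perf R ⥤ ChainComplex (ModuleCat.{u} ℤ) ℤ where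
  obj := s.complex
  map {V V'} g :=
    { f := fun i => ModuleCat.ofHom (intLinear (s.extMap g i))
      comm' := fun i j hij => by
        obtain rfl : j = i - 1 := eq_sub_of_add_eq hij
        rw [complex_d, complex_d]
        ext x
        exact s.extD_extMap g i x }
  map_id V := by
    ext i x
    refine DFunLike.congr_fun (hom_ext (f := s.extMap (𝟙 V) i) (g := AddMonoidHom.id _)
      (fun x => ?_) fun v => ?_) x
    · rw [extMap_incl, mapElt_id]; rfl
    · rw [extMap_sec]; rfl
  map_comp g g' := by
    ext i x
    refine DFunLike.congr_fun (hom_ext (f := s.extMap (g ≫ g') i)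
      (g := (s.extMap g' i).comp (s.extMap g i)) (fun x => ?_) fun v => ?_) x
    · change _ = s.extMap g' i (s.extMap g i _)
      rw [extMap_incl, extMap_incl, extMap_incl, mapElt_comp]
    · change _ = s.extMap g' i (s.extMap g i _)
      rw [extMap_sec, extMap_sec, extMap_sec]; rfl

/-- The inclusion of `C` on elements. -/
def inclElt (V : Perf R) (i : ℤ) : (φ.C.obj V).X i →+ (s.functor.obj V).X i :=
  incl (s.cocycle V i)

/-- The natural section of the projection to the shifted complex, on elements. -/
def secElt (V : Perf R) (i : ℤ) : V.obj.X (i - 1) → (s.functor.obj V).X i :=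
  sec (s.cocycle V i)

/-- The projection to the shifted complex, on elements. -/
def projElt (V : Perf R) (i : ℤ) (x : (s.functor.obj V).X i) : V.obj.X (i - 1) :=
  SymmCocycle.Extension.snd (c := s.cocycle V i) x

variable {s} {V V' : Perf R} {i : ℤ}

theorem exists_eq_inclElt_add (x : (s.functor.obj V).X i) :
    ∃ y v, x = s.inclElt V i y + s.secElt V i v := ⟨_, _, eq_incl_add_sec (c := s.cocycle V i) x⟩

theorem projElt_add (y : (φ.C.obj V).X i) (v : V.obj.X (i - 1)) :
    s.projElt V i (s.inclElt V i y + s.secElt V i v) = v := zero_add v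

theorem inclElt_injective : Function.Injective (s.inclElt V i) := fun _ _ h =>
  congrArg (SymmCocycle.Extension.fst (c := s.cocycle V i)) h

theorem secElt_zero : s.secElt V i 0 = 0 := rfl

theorem inclElt_add_eq {y y' : (φ.C.obj V).X i} {v v' : V.obj.X (i - 1)}
    (h : s.inclElt V i y + s.secElt V i v = s.inclElt V i y' + s.secElt V i v') :
    y = y' ∧ v = v' := by
  have hv := congrArg (s.projElt V i) h
  rw [projElt_add, projElt_add] at hv
  subst hv
  exact ⟨inclElt_injective (add_right_cancel h), rfl⟩

theorem d_inclElt (j : ℤ) (x : (φ.C.obj V).X i) :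
    ((s.functor.obj V).d i j).hom (s.inclElt V i x) =
      s.inclElt V j (((φ.C.obj V).d i j).hom x) := by
  by_cases h : j + 1 = i
  · obtain rfl : j = i - 1 := eq_sub_of_add_eq h
    exact (congrArg (fun f => f.hom (s.inclElt V i x)) (s.complex_d V i)).trans (s.extD_incl V i x)
  · rw [(s.functor.obj V).shape _ _ h, (φ.C.obj V).shape _ _ h]
    exact (map_zero (s.inclElt V j)).symm

theorem d_secElt (v : V.obj.X (i - 1)) :
    ((s.functor.obj V).d i (i - 1)).hom (s.secElt V i v) = s.inclElt V (i - 1) (s.τ (i - 1) V v) -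
      s.secElt V (i - 1) ((V.obj.d (i - 1) (i - 1 - 1)).hom v) :=
  (congrArg (fun f => f.hom (s.secElt V i v)) (s.complex_d V i)).trans (s.extD_sec V i v)

theorem map_inclElt (g : V ⟶ V') (x : (φ.C.obj V).X i) :
    mapElt s.functor g i (s.inclElt V i x) = s.inclElt V' i (mapElt φ.C g i x) :=
  s.extMap_incl g i x

theorem map_secElt (g : V ⟶ V') (v : V.obj.X (i - 1)) :
    mapElt s.functor g i (s.secElt V i v) = s.secElt V' i ((g.hom.f (i - 1)).hom v) :=
  s.extMap_sec g i v

section desc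

variable {G : Perf R ⥤ ChainComplex (ModuleCat.{u} ℤ) ℤ} (f : φ.C ⟶ G)
    (g : ∀ (V : Perf R) (i : ℤ), V.obj.X (i - 1) → (G.obj V).X i)
    (hadd : ∀ (V : Perf R) (i : ℤ) (v w : V.obj.X (i - 1)), g V i v + g V i w = g V i (v + w) +
      ((f.app V).f i).hom (s.σ (i - 1) i (sub_add_cancel i 1) V v w))

variable (V i) in
/-- The homomorphism out of `C^r` given by a map on `C` and a function on the shifted complex. -/
def descElt : (s.functor.obj V).X i →+ (G.obj V).X i :=
  lift (c := s.cocycle V i) ((f.app V).f i).hom.toAddMonoidHom (g V i) (hadd V i)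

theorem descElt_inclElt (x : (φ.C.obj V).X i) :
    descElt V i f g hadd (s.inclElt V i x) = ((f.app V).f i).hom x :=
  lift_incl _ _ _ _

theorem descElt_secElt (v : V.obj.X (i - 1)) :
    descElt V i f g hadd (s.secElt V i v) = g V i v :=
  lift_sec _ _ _ _

variable (nat : ∀ (V V' : Perf R) (p : V ⟶ V') (i : ℤ) (v : V.obj.X (i - 1)),
      mapElt G p i (g V i v) = g V' i ((p.hom.f (i - 1)).hom v))
    (hd : ∀ (V : Perf R) (i : ℤ) (v : V.obj.X (i - 1)), ((G.obj V).d i (i - 1)).hom (g V i v) =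
      ((f.app V).f (i - 1)).hom (s.τ (i - 1) V v) -
        g V (i - 1) ((V.obj.d (i - 1) (i - 1 - 1)).hom v))

/-- A natural transformation out of `C^r` from a natural transformation out of `C` and
a compatible natural family of functions. -/
def descHom : s.functor ⟶ G where
  app V :=
    { f := fun i => ModuleCat.ofHom (intLinear (descElt V i f g hadd))
      comm' := fun i j hij => by
        obtain rfl : j = i - 1 := eq_sub_of_add_eq hij
        refine ModuleCat.hom_ext (LinearMap.ext fun x => ?_)
        change ((G.obj V).d i (i - 1)).hom (descElt V i f g hadd x) =
          descElt V (i - 1) f g hadd (((s.functor.obj V).d i (i - 1)).hom x)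
        obtain ⟨y, v, rfl⟩ := exists_eq_inclElt_add x
        simp only [map_add, map_sub, descElt_inclElt, descElt_secElt, d_inclElt, d_secElt, hd,
          hom_d_comm] }
  naturality V V' p := by
    refine HomologicalComplex.hom_ext _ _ fun i => ModuleCat.hom_ext (LinearMap.ext fun x => ?_)
    change descElt V' i f g hadd (mapElt s.functor p i x) = mapElt G p i (descElt V i f g hadd x)
    obtain ⟨y, v, rfl⟩ := exists_eq_inclElt_add x
    simp only [map_add, descElt_inclElt, descElt_secElt, map_inclElt, map_secElt, nat, mapElt_app]

theorem descHom_inclElt (x : (φ.C.obj V).X i) :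
    (((descHom f g hadd nat hd).app V).f i).hom (s.inclElt V i x) = ((f.app V).f i).hom x :=
  descElt_inclElt _ _ hadd x

theorem descHom_secElt (v : V.obj.X (i - 1)) :
    (((descHom f g hadd nat hd).app V).f i).hom (s.secElt V i v) = g V i v :=
  descElt_secElt _ _ hadd v

end desc

variable (s) in
/-- The map `r : C ⟶ C^r`. -/
def r : φ.C ⟶ s.functor where
  app V :=
    { f := fun i => ModuleCat.ofHom (intLinear (s.inclElt V i))
      comm' := fun i j _ => by
        ext x
        exact d_inclElt j x }
  naturality V V' p := by
    ext i x
    exact (map_inclElt p x).symm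

variable (s) in
/-- The map `a^r : C^r ⟶ Cone`. -/
def ar : s.functor ⟶ conePerf R :=
  descHom (φ.a ≫ conePerfIncl R) (fun V i v => coneInl V i v)
    (fun V i v w => by
      change _ = _ + coneInr V i (aElt φ V i (s.σ _ _ _ V v w))
      rw [s.a_σ, map_zero, add_zero, map_add])
    (fun _ _ p i v => map_coneInl p i v)
    (fun V i v => by
      refine (d_coneInl i v).trans ?_
      change _ = coneInr V (i - 1) (aElt φ V (i - 1) (s.τ (i - 1) V v)) - _
      rw [s.a_τ])

theorem ar_inclElt (x : (φ.C.obj V).X i) :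
    ((s.ar.app V).f i).hom (s.inclElt V i x) = coneInr V i (aElt φ V i x) :=
  descHom_inclElt _ _ _ _ _ x

theorem ar_secElt (v : V.obj.X (i - 1)) :
    ((s.ar.app V).f i).hom (s.secElt V i v) = coneInl V i v :=
  descHom_secElt _ _ _ _ _ v

end CocycleSection

end

end DGSplitting

namespace DGSplitting

noncomputable section

/-! ### Pullback squares of functors, elementwise. -/

section Pullbacks

/-- The pullback property is left exactness of $X_1\to X_2\oplus X_3\to X_4$; since $r$ is epi, so
is the last map, which is then a cokernel. -/
theorem isPushout_of_isPullback {A : Type*} [Category* A] [Abelian A] {X₁ X₂ X₃ X₄ : A}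
    {t : X₁ ⟶ X₂} {l : X₁ ⟶ X₃} {r : X₂ ⟶ X₄} {b : X₃ ⟶ X₄} (h : IsPullback t l r b) [Epi r] :
    IsPushout t l r b := by
  have : Epi h.shortComplex'.g := by
    have hr : biprod.inl ≫ h.shortComplex'.g = r := biprod.inl_desc _ _
    have : Epi (biprod.inl ≫ h.shortComplex'.g) := by rwa [hr]
    exact epi_of_epi biprod.inl _
  have hs (s : PushoutCocone t l) :
      ∃ k : X₄ ⟶ s.pt, r ≫ k = s.inl ∧ b ≫ k = s.inr := by
    have hz : biprod.lift t l ≫ biprod.desc s.inl (-s.inr) = 0 := by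
      rw [biprod.lift_desc, Preadditive.comp_neg, s.condition, add_neg_cancel]
    obtain ⟨k, hk⟩ : ∃ k : X₄ ⟶ s.pt, biprod.desc r (-b) ≫ k = biprod.desc s.inl (-s.inr) :=
      ⟨_, h.exact_shortComplex'.g_desc _ hz⟩
    refine ⟨k, ?_, ?_⟩
    · rw [← biprod.inl_desc r (-b), Category.assoc, hk, biprod.inl_desc]
    · rw [← neg_inj, ← Preadditive.neg_comp, ← biprod.inr_desc r (-b), Category.assoc, hk,
        biprod.inr_desc]
  choose k hk hk' using hs
  exact ⟨⟨h.w⟩, ⟨PushoutCocone.IsColimit.mk h.w k hk hk' fun s m hm _ => by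
    rw [← cancel_epi r, hm, hk]⟩⟩

theorem isPullback_of_eval {A ι : Type*} [Category* A] [HasZeroMorphisms A] {c : ComplexShape ι}
    {X₁ X₂ X₃ X₄ : HomologicalComplex A c} {t : X₁ ⟶ X₂} {l : X₁ ⟶ X₃} {r : X₂ ⟶ X₄}
    {b : X₃ ⟶ X₄} (h : ∀ i, IsPullback (t.f i) (l.f i) (r.f i) (b.f i)) : IsPullback t l r b := by
  have w : t ≫ r = l ≫ b := HomologicalComplex.hom_ext _ _ fun i => (h i).w
  have hw (s : PullbackCone r b) (i : ι) : s.fst.f i ≫ r.f i = s.snd.f i ≫ b.f i :=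
    HomologicalComplex.congr_hom s.condition i
  refine ⟨⟨w⟩, ⟨PullbackCone.IsLimit.mk w (fun s =>
    { f := fun i => (h i).lift (s.fst.f i) (s.snd.f i) (hw s i)
      comm' := fun i j _ => (h j).hom_ext
        (by rw [Category.assoc, Category.assoc, ← t.comm, (h i).lift_fst_assoc, (h j).lift_fst,
          s.fst.comm])
        (by rw [Category.assoc, Category.assoc, ← l.comm, (h i).lift_snd_assoc, (h j).lift_snd,
          s.snd.comm]) })
    (fun s => ?_) (fun s => ?_) fun s m hm hm' => ?_⟩⟩
  · ext i; exact (h i).lift_fst _ _ _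
  · ext i; exact (h i).lift_snd _ _ _
  · ext i
    refine (h i).hom_ext ?_ ?_
    · exact (HomologicalComplex.congr_hom hm i).trans ((h i).lift_fst _ _ _).symm
    · exact (HomologicalComplex.congr_hom hm' i).trans ((h i).lift_snd _ _ _).symm

variable {S : Type*} [Ring S] {D : Type*} [Category* D]

theorem isPullback_iff_elementwise {X₁ X₂ X₃ X₄ : D ⥤ ChainComplex (ModuleCat.{u} S) ℤ}
    {t : X₁ ⟶ X₂} {l : X₁ ⟶ X₃} {r : X₂ ⟶ X₄} {b : X₃ ⟶ X₄} :
    IsPullback t l r b ↔ t ≫ r = l ≫ b ∧ ∀ (V : D) (i : ℤ),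
      (∀ x y, ((t.app V).f i).hom x = ((t.app V).f i).hom y →
        ((l.app V).f i).hom x = ((l.app V).f i).hom y → x = y) ∧
      ∀ x y, ((r.app V).f i).hom x = ((b.app V).f i).hom y →
        ∃ z, ((t.app V).f i).hom z = x ∧ ((l.app V).f i).hom z = y := by
  constructor
  · intro h
    refine ⟨h.w, fun V i => ?_⟩
    have h' := ((h.map ((evaluation _ _).obj V)).map
      (HomologicalComplex.eval _ _ i)).map (forget (ModuleCat.{u} S))
    obtain ⟨-, h₁, h₂⟩ := (Types.isPullback_iff _ _ _ _).1 h'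
    exact ⟨fun x y hx hy => h₁ x y ⟨hx, hy⟩, fun x y hxy => h₂ x y hxy⟩
  · rintro ⟨w, h⟩
    refine IsPullback.of_forall_isPullback_app fun V => isPullback_of_eval fun i => ?_
    have w' : (t.app V).f i ≫ (r.app V).f i = (l.app V).f i ≫ (b.app V).f i :=
      HomologicalComplex.congr_hom (NatTrans.congr_app w V) i
    refine IsPullback.of_map (forget (ModuleCat.{u} S)) w' ?_
    refine (Types.isPullback_iff _ _ _ _).2 ⟨?_, fun x y hxy => (h V i).1 x y hxy.1 hxy.2,
      fun x y hxy => (h V i).2 x y hxy⟩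
    rw [← Functor.map_comp, ← Functor.map_comp, w']

end Pullbacks

/-! ### The model is an admissible strict splitting. -/

namespace CocycleSection

variable {R : Type u} [Ring R] {W : Type u} [AddCommGroup W] [Module Rᵐᵒᵖ W]
  {φ : ElementaryExtension R W} (s : CocycleSection φ)

variable {s} in
theorem eq_zero_of_inclElt_add_secElt {V : Perf R} {i : ℤ} {y : (φ.C.obj V).X i}
    {v : V.obj.X (i - 1)} (h : s.inclElt V i y + s.secElt V i v = 0) : y = 0 ∧ v = 0 :=
  inclElt_add_eq (s := s) (y' := 0) (v' := 0)
    (by rw [h, map_zero, secElt_zero, add_zero])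

variable {s} in
theorem eq_of_inclElt_eq {V : Perf R} {i : ℤ} {y y' : (φ.C.obj V).X i}
    {v : V.obj.X (i - 1)} (h : s.inclElt V i y = s.inclElt V i y' + s.secElt V i v) :
    y = y' ∧ v = 0 := by
  obtain ⟨h₁, h₂⟩ := inclElt_add_eq (s := s) (y := y) (y' := y') (v := 0) (v' := v)
    (by rw [secElt_zero, add_zero, h])
  exact ⟨h₁, h₂.symm⟩

theorem isPointed : IsPointed s.functor := by
  intro V hV
  rw [IsZero.iff_id_eq_zero]
  refine HomologicalComplex.hom_ext _ _ fun i => ModuleCat.hom_ext (LinearMap.ext fun x => ?_)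
  have h₁ : Subsingleton ((φ.C.obj V).X i) := ModuleCat.subsingleton_of_isZero
    ((HomologicalComplex.eval _ _ i).map_isZero (φ.admissible.pointed V hV))
  have h₂ : Subsingleton (V.obj.X (i - 1)) := ModuleCat.subsingleton_of_isZero
    ((HomologicalComplex.eval _ _ (i - 1)).map_isZero hV)
  change x = 0
  obtain ⟨y, v, rfl⟩ := exists_eq_inclElt_add x
  rw [Subsingleton.elim y 0, Subsingleton.elim v 0, map_zero, secElt_zero, add_zero]

theorem isAdmissible : IsAdmissible s.functor where
  pointed := s.isPointed
  acyclic V hV := by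
    have hC := (acyclic_iff _).1 (φ.admissible.acyclic V hV)
    rw [acyclic_iff] at hV ⊢
    intro i j k hij hjk x hx
    obtain rfl : j = i - 1 := eq_sub_of_add_eq hij
    obtain rfl : k = i - 1 - 1 := eq_sub_of_add_eq hjk
    obtain ⟨y, v, rfl⟩ := exists_eq_inclElt_add x
    rw [map_add, d_inclElt, d_secElt, ← add_sub_assoc, ← map_add, sub_eq_zero] at hx
    obtain ⟨hy, hv⟩ := eq_of_inclElt_eq (y' := 0) (hx.trans (by rw [map_zero, zero_add]))
    obtain ⟨u, rfl⟩ := hV (i - 1) (i - 1 - 1) (i - 1 - 1 - 1) (by omega) (by omega) v hv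
    -- The cycle condition is $dy+\tau(du)=0$, so $y+\tau u$ is a cycle of $C$.
    obtain ⟨y', hy'⟩ := hC i (i - 1) (i - 1 - 1) hij hjk (y + s.τ (i - 1) V u) (by
      rw [map_add, s.d_τ _ _ (sub_add_cancel _ 1), hy])
    refine ⟨s.inclElt V i y' - s.secElt V i u, ?_⟩
    rw [map_sub, d_inclElt, d_secElt, hy', map_add]
    abel
  quasiExact {X Y Z} f g w h := by
    have hC := (quasiExact_iff _ _).1 (φ.admissible.quasiExact f g w h)
    have hf := (mono_iff_injective _).1 h.mono_f
    have hg := (epi_iff_surjective _).1 h.epi_g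
    have he := (exact_iff _ _ _).1 h.exact
    refine (quasiExact_iff _ _).2 ⟨fun i x => ?_, fun i => ?_, fun i z => ?_, ?_⟩
    · exact (mapElt_comp s.functor f g i x).trans (mapElt_zero s.isPointed w i x)
    · change Function.Injective (mapElt s.functor f i)
      rw [injective_iff_map_eq_zero]
      intro x hx
      obtain ⟨y, v, rfl⟩ := exists_eq_inclElt_add x
      rw [map_add, map_inclElt, map_secElt] at hx
      obtain ⟨hy, hv⟩ := eq_zero_of_inclElt_add_secElt hx
      rw [hC.2.1 i (hy.trans (map_zero _).symm), hf (i - 1) (hv.trans (map_zero _).symm),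
        map_zero, secElt_zero, add_zero]
    · obtain ⟨z, w, rfl⟩ := exists_eq_inclElt_add z
      obtain ⟨y, hy⟩ := hC.2.2.1 i z
      obtain ⟨v, rfl⟩ := hg (i - 1) w
      refine ⟨s.inclElt Y i y + s.secElt Y i v, ?_⟩
      change mapElt s.functor g i _ = _
      rw [map_add, map_inclElt, map_secElt, ← hy]
      rfl
    · intro i j k hij hjk x t hx ht
      obtain rfl : k = j - 1 := eq_sub_of_add_eq hjk
      obtain ⟨y, v, rfl⟩ := exists_eq_inclElt_add x
      obtain ⟨t, u', rfl⟩ := exists_eq_inclElt_add t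
      change mapElt s.functor g j _ = 0 at hx
      change _ = mapElt s.functor f (j - 1) _ at ht
      rw [map_add, map_inclElt, map_secElt] at hx
      obtain ⟨hy, hv⟩ := eq_zero_of_inclElt_add_secElt hx
      obtain ⟨u, hu⟩ := he (j - 1) v hv
      change (f.hom.f (j - 1)).hom u = v at hu
      subst hu
      -- Removing the image of the section at $u$ leaves an element of $C$ whose boundary still
      -- comes from $X$, so quasiexactness of $C$ finishes the argument.
      have hty : s.inclElt Y (j - 1) (((φ.C.obj Y).d j (j - 1)).hom y) = mapElt s.functor f (j - 1)
          (s.inclElt X (j - 1) t + s.secElt X (j - 1) u' -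
            ((s.functor.obj X).d j (j - 1)).hom (s.secElt X j u)) := by
        rw [map_sub, ← ht, ← d_mapElt, map_secElt, map_add, add_sub_cancel_right, d_inclElt]
      obtain ⟨t', u'', hx'⟩ := exists_eq_inclElt_add (s.inclElt X (j - 1) t +
        s.secElt X (j - 1) u' - ((s.functor.obj X).d j (j - 1)).hom (s.secElt X j u))
      rw [hx', map_add, map_inclElt, map_secElt] at hty
      obtain ⟨ht', -⟩ := eq_of_inclElt_eq hty
      obtain ⟨y', x', hy', rfl⟩ := hC.2.2.2 i j (j - 1) hij hjk y t' hy ht'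
      refine ⟨s.inclElt Y i y', s.inclElt X j x' + s.secElt X j u, ?_, ?_⟩
      · exact (map_inclElt g y').trans ((congrArg _ hy').trans (map_zero _))
      · change _ = mapElt s.functor f j _ + _
        rw [map_add, map_add, map_inclElt, map_secElt, d_inclElt]
        change s.inclElt Y j (mapElt φ.C f j x') + _ + _ = _
        abel

theorem comm : s.r ≫ s.ar = φ.a ≫ conePerfIncl R := by
  ext V i x
  exact ar_inclElt x

/-- The kernel of $a^r$ is the image under $r$ of $\operatorname{Ker} a$, so acyclicity is inherited
from the extension. -/
theorem quasiExact (V : Perf R) : QuasiExact ((φ.b ≫ s.r).app V) (s.ar.app V) := by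
  have hφ := (quasiExact_iff _ _).1 (φ.quasiExact V)
  refine (quasiExact_iff _ _).2 ⟨fun i x => ?_, fun i => ?_, fun i z => ?_, ?_⟩
  · exact (ar_inclElt _).trans ((congrArg _ (aElt_bElt (φ := φ) x)).trans (map_zero _))
  · exact inclElt_injective.comp (bElt_injective V i)
  · obtain ⟨v, w, rfl⟩ := exists_cone_eq z
    obtain ⟨y, rfl⟩ := aElt_surjective (φ := φ) V i w
    exact ⟨s.inclElt V i y + s.secElt V i v, by
      rw [map_add, ar_inclElt, ar_secElt, add_comm]⟩
  · intro i j k hij hjk y x hy hx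
    obtain ⟨y, v, rfl⟩ := exists_eq_inclElt_add y
    rw [map_add, ar_inclElt, ar_secElt, add_comm] at hy
    obtain ⟨hv, hy0⟩ := cone_eq_zero hy
    subst hv
    replace hy : ((φ.a.app V).f j).hom y = 0 := hy0
    rw [secElt_zero, add_zero] at hx ⊢
    rw [d_inclElt] at hx
    obtain ⟨y', x', hy', h⟩ := hφ.2.2.2 i j k hij hjk y x hy (inclElt_injective hx)
    refine ⟨s.inclElt V i y', x', ?_, ?_⟩
    · rw [ar_inclElt]
      exact (congrArg _ hy').trans (map_zero _)
    · rw [h, map_add, d_inclElt]; rfl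

/-- The right DG splitting defined by a cocycle section. -/
def splitting : RightSplitting φ where
  Cr := s.functor
  pointed := s.isPointed
  r := s.r
  ar := s.ar
  comm := s.comm
  quasiExact := s.quasiExact

theorem isStrict : s.splitting.IsStrict := by
  have h : IsPullback s.r φ.a s.ar (conePerfIncl R) := by
    rw [isPullback_iff_elementwise]
    refine ⟨s.comm, fun V i => ⟨fun x y h _ => inclElt_injective h, fun x w hx => ?_⟩⟩
    obtain ⟨y, v, rfl⟩ := exists_eq_inclElt_add x
    change V.obj.X i at w
    replace hx : ((s.ar.app V).f i).hom (s.inclElt V i y + s.secElt V i v) = coneInr V i w := hx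
    rw [map_add, ar_inclElt, ar_secElt, ← sub_eq_zero, add_comm, add_sub_assoc,
      ← map_sub] at hx
    obtain ⟨rfl, hw⟩ := cone_eq_zero hx
    exact ⟨y, by rw [secElt_zero, add_zero]; rfl, sub_eq_zero.1 hw⟩
  have : ∀ V, Epi (s.ar.app V) := fun V => (s.quasiExact V).2.2.1
  have : Epi s.ar := NatTrans.epi_of_epi_app _
  have h' : IsPushout s.r φ.a s.ar (conePerfIncl R) := isPushout_of_isPullback h
  exact ⟨h, h'.isColimit'⟩

end CocycleSection

end

end DGSplitting

namespace DGSplitting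

noncomputable section

/-! ### Natural sections in an arbitrary strict splitting. -/

theorem exists_int_chain {α : ℤ → Type*} (P : ∀ i, α (i - 1) → α i → Prop) (x₀ : α 0)
    (up : ∀ i x, ∃ y, P i x y) (down : ∀ i y, ∃ x, P i x y) :
    ∃ f : ∀ i, α i, ∀ i, P i (f (i - 1)) (f i) := by
  -- A free index `j` lets the recursion follow the constructors of `ℤ` without casts.
  let P' (i j : ℤ) (h : j = i - 1) (x : α j) (y : α i) : Prop := P i (h ▸ x) y
  have up' : ∀ i j h x, ∃ y, P' i j h x y := by
    rintro i _ rfl x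
    exact up i x
  have down' : ∀ i j h y, ∃ x, P' i j h x y := by
    rintro i _ rfl y
    exact down i y
  choose u hu using up'
  choose d hd using down'
  let f : (i : ℤ) → α i
    | .ofNat k => Nat.rec x₀ (fun k x => u (k + 1 : ℕ) k (by omega) x) k
    | .negSucc k => Nat.rec (d 0 (.negSucc 0) (by omega) x₀)
        (fun k y => d (.negSucc k) (.negSucc (k + 1)) (by omega) y) k
  have hf : ∀ i j h, P' i j h (f j) (f i) := by
    intro i j h
    obtain rfl : i = j + 1 := by omega
    rcases j with k | k
    · exact hu (k + 1 : ℕ) k _ _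
    · rcases k with - | k
      · exact hd 0 (.negSucc 0) _ _
      · exact hd (.negSucc k) (.negSucc (k + 1)) _ _
  exact ⟨f, fun i => hf i (i - 1) rfl⟩

namespace RightSplitting

variable {R : Type u} [Ring R] {W : Type u} [AddCommGroup W] [Module Rᵐᵒᵖ W]
  {φ : ElementaryExtension R W} (T : RightSplitting φ)

/-- The map `r` on elements. -/
def rElt (V : Perf R) (i : ℤ) : (φ.C.obj V).X i →+ (T.Cr.obj V).X i :=
  ((T.r.app V).f i).hom.toAddMonoidHom

/-- The map `a^r` on elements. -/
def arElt (V : Perf R) (i : ℤ) : (T.Cr.obj V).X i →+ ((conePerf R).obj V).X i :=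
  ((T.ar.app V).f i).hom.toAddMonoidHom

variable {T} {V V' : Perf R} {i : ℤ}

theorem arElt_rElt (x : (φ.C.obj V).X i) :
    T.arElt V i (T.rElt V i x) = coneInr V i (aElt φ V i x) :=
  congrArg (fun f => ((f.app V).f i).hom x) T.comm

theorem mapElt_rElt (g : V ⟶ V') (x : (φ.C.obj V).X i) :
    mapElt T.Cr g i (T.rElt V i x) = T.rElt V' i (mapElt φ.C g i x) :=
  mapElt_app T.r g i x

theorem d_rElt (j : ℤ) (x : (φ.C.obj V).X i) :
    ((T.Cr.obj V).d i j).hom (T.rElt V i x) = T.rElt V j (((φ.C.obj V).d i j).hom x) :=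
  hom_d_comm _ _ _ _

theorem arElt_mapElt (g : V ⟶ V') (x : (T.Cr.obj V).X i) :
    T.arElt V' i (mapElt T.Cr g i x) = mapElt (conePerf R) g i (T.arElt V i x) :=
  (mapElt_app T.ar g i x).symm

theorem arElt_d (j : ℤ) (x : (T.Cr.obj V).X i) :
    T.arElt V j (((T.Cr.obj V).d i j).hom x) =
      (((conePerf R).obj V).d i j).hom (T.arElt V i x) :=
  (hom_d_comm (T.ar.app V) i j x).symm

variable (T) in
theorem arElt_surjective (V : Perf R) (i : ℤ) : Function.Surjective (T.arElt V i) :=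
  ((quasiExact_iff _ _).1 (T.quasiExact V)).2.2.1 i

theorem rElt_injective (hT : T.IsStrict) : Function.Injective (T.rElt V i) := by
  intro x y h
  refine ((isPullback_iff_elementwise.1 hT.toIsPullback).2 V i).1 x y h ?_
  refine coneInr_injective V i ?_
  change coneInr V i (aElt φ V i x) = coneInr V i (aElt φ V i y)
  rw [← arElt_rElt, ← arElt_rElt, h]

theorem exists_rElt_eq (hT : T.IsStrict) {y : (T.Cr.obj V).X i} {w : V.obj.X i}
    (h : T.arElt V i y = coneInr V i w) :
    ∃ x, T.rElt V i x = y ∧ aElt φ V i x = w :=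
  ((isPullback_iff_elementwise.1 hT.toIsPullback).2 V i).2 y w h

-- Strictness places the error of an arbitrary lift in $r(\operatorname{Ker} a)$, where it is a
-- boundary for degree reasons.
variable (i) in
theorem exists_sphere_lift (hT : T.IsStrict) (s : NaturalSection φ) :
    ∃ c : (T.Cr.obj (sphere R 1 (i - 1))).X i,
    T.arElt _ i c = coneInl _ i (sphereGen R 1 (i - 1) 0) ∧
    ((T.Cr.obj _).d i (i - 1)).hom c =
      T.rElt _ (i - 1) (s.τ (i - 1) _ (sphereGen R 1 (i - 1) 0)) := by
  obtain ⟨y, hy⟩ := T.arElt_surjective _ i (coneInl _ i (sphereGen R 1 (i - 1) 0))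
  obtain ⟨z, hz, haz⟩ := exists_rElt_eq hT (w := 0) (y := ((T.Cr.obj _).d i (i - 1)).hom y -
      T.rElt _ (i - 1) (s.τ (i - 1) _ (sphereGen R 1 (i - 1) 0))) (by
    rw [map_sub, arElt_d, hy, d_coneInl, arElt_rElt, s.a_τ, sphere_d, map_zero, map_zero, sub_zero,
      sub_self])
  obtain ⟨w, hw, rfl⟩ := exists_d_eq (sub_add_cancel i 1) (sub_add_cancel (i - 1) 1)
    (isZero_sphere_X (by omega)) z haz (rElt_injective hT (by
      rw [← d_rElt, hz, map_sub, d_d_apply, d_rElt, s.d_τ _ _ (sub_add_cancel (i - 1) 1), sphere_d,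
        s.τ_zero, map_zero, sub_zero]))
  refine ⟨y - T.rElt _ i w, ?_, ?_⟩
  · rw [map_sub, hy, arElt_rElt, hw, map_zero, sub_zero]
  · rw [map_sub, d_rElt, hz, sub_sub_cancel]

theorem exists_disk_lift (hT : T.IsStrict) (s : NaturalSection φ)
    {c : (T.Cr.obj (sphere R 1 (i - 1 - 1))).X (i - 1)}
    (hc : T.arElt _ (i - 1) c = coneInl _ (i - 1) (sphereGen R 1 (i - 1 - 1) 0))
    (hdc : ((T.Cr.obj _).d (i - 1) (i - 1 - 1)).hom c =
      T.rElt _ (i - 1 - 1) (s.τ (i - 1 - 1) _ (sphereGen R 1 (i - 1 - 1) 0))) :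
    ∃ x : (T.Cr.obj (disk R 1 (i - 1))).X i,
      T.arElt _ i x = coneInl _ i (diskGen R 1 (i - 1) 0) ∧
      ((T.Cr.obj _).d i (i - 1)).hom x = T.rElt _ (i - 1) (s.τ (i - 1) _ (diskGen R 1 (i - 1) 0)) -
        mapElt T.Cr (sphereToDisk R 1 (i - 1 - 1) (i - 1)) (i - 1) c := by
  obtain ⟨y, hy⟩ := T.arElt_surjective _ i (coneInl _ i (diskGen R 1 (i - 1) 0))
  obtain ⟨z, hz, -⟩ := exists_rElt_eq hT (w := 0) (y := ((T.Cr.obj _).d i (i - 1)).hom y -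
      (T.rElt _ (i - 1) (s.τ (i - 1) _ (diskGen R 1 (i - 1) 0)) -
        mapElt T.Cr (sphereToDisk R 1 (i - 1 - 1) (i - 1)) (i - 1) c)) (by
    rw [map_sub, map_sub, arElt_d, hy, d_coneInl, arElt_rElt, s.a_τ, arElt_mapElt, hc, map_coneInl,
      sphereHom_gen, sub_self, map_zero])
  obtain ⟨w, rfl⟩ := exists_disk_d_eq (sub_add_cancel i 1) z (rElt_injective hT (by
    rw [← d_rElt, hz, map_sub, map_sub, d_d_apply, d_rElt, s.d_τ _ _ (sub_add_cancel (i - 1) 1),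
      d_mapElt, hdc, mapElt_rElt, s.natural, sphereHom_gen, sub_self, sub_zero, map_zero]))
  have : Subsingleton ((disk R 1 (i - 1)).obj.X i) :=
    ModuleCat.subsingleton_of_isZero (concentratedLE_disk (i - 1) i (by omega))
  refine ⟨y - T.rElt _ i w, ?_, ?_⟩
  · rw [map_sub, hy, arElt_rElt, Subsingleton.elim (aElt φ _ i w) 0, map_zero, sub_zero]
  · rw [map_sub, d_rElt, hz, sub_sub_cancel]

/-- Here $T$ is only pointed, so $T(\mathrm{disk})\to T(\mathrm{sphere})$ is not known to be
surjective and the choices in adjacent degrees must be made compatible, by recursion in both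
directions from degree $0$. -/
theorem exists_lifts (hT : T.IsStrict) (s : NaturalSection φ) :
    ∃ (c : ∀ i, (T.Cr.obj (sphere R 1 (i - 1))).X i)
    (x : ∀ i, (T.Cr.obj (disk R 1 (i - 1))).X i),
    (∀ i, mapElt T.Cr (diskToSphere R 1 (i - 1)) i (x i) = c i) ∧
    (∀ i, T.arElt _ i (x i) = coneInl _ i (diskGen R 1 (i - 1) 0)) ∧
    ∀ i, ((T.Cr.obj _).d i (i - 1)).hom (x i) =
      T.rElt _ (i - 1) (s.τ (i - 1) _ (diskGen R 1 (i - 1) 0)) -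
        mapElt T.Cr (sphereToDisk R 1 (i - 1 - 1) (i - 1)) (i - 1) (c (i - 1)) := by
  let α (i : ℤ) := {c : (T.Cr.obj (sphere R 1 (i - 1))).X i //
    T.arElt _ i c = coneInl _ i (sphereGen R 1 (i - 1) 0) ∧ ((T.Cr.obj _).d i (i - 1)).hom c =
      T.rElt _ (i - 1) (s.τ (i - 1) _ (sphereGen R 1 (i - 1) 0))}
  let P (i : ℤ) (c : α (i - 1)) (c' : α i) : Prop := ∃ x : (T.Cr.obj (disk R 1 (i - 1))).X i,
    mapElt T.Cr (diskToSphere R 1 (i - 1)) i x = c'.1 ∧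
    T.arElt _ i x = coneInl _ i (diskGen R 1 (i - 1) 0) ∧
    ((T.Cr.obj _).d i (i - 1)).hom x = T.rElt _ (i - 1) (s.τ (i - 1) _ (diskGen R 1 (i - 1) 0)) -
        mapElt T.Cr (sphereToDisk R 1 (i - 1 - 1) (i - 1)) (i - 1) c.1
  have hα (i : ℤ) : Nonempty (α i) := by
    obtain ⟨c, hc⟩ := exists_sphere_lift i hT s
    exact ⟨⟨c, hc⟩⟩
  have up (i : ℤ) (c : α (i - 1)) : ∃ c', P i c c' := by
    obtain ⟨x, hx, hdx⟩ := exists_disk_lift hT s c.2.1 c.2.2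
    refine ⟨⟨mapElt T.Cr (diskToSphere R 1 (i - 1)) i x, ?_, ?_⟩, x, rfl, hx, hdx⟩
    · rw [arElt_mapElt, hx, map_coneInl, diskHom_gen]
    · rw [d_mapElt, hdx, map_sub, mapElt_rElt, s.natural, diskHom_gen, mapElt_comp,
        mapElt_zero (g := sphereToDisk R 1 (i - 1 - 1) (i - 1) ≫ diskToSphere R 1 (i - 1)) T.pointed
          (sphereToDisk_diskToSphere (sub_add_cancel (i - 1) 1)), sub_zero]
  have down (i : ℤ) (c' : α i) : ∃ c, P i c c' := by
    obtain ⟨c⟩ := hα (i - 1)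
    obtain ⟨c'', x, hx, hax, hdx⟩ := up i c
    obtain ⟨y, hy, hay⟩ := exists_rElt_eq hT (y := c'.1 - c''.1) (w := 0) (by
      rw [map_sub, c'.2.1, c''.2.1, sub_self, map_zero])
    -- Two choices differ by $r$ of a top-degree cycle, hence by $rb(t)$; the tensor functor, unlike
    -- $T$, lets $t$ be lifted to the disk.
    obtain ⟨t, rfl⟩ := exists_bElt_eq (sub_add_cancel i 1) (concentratedLE_sphere (i - 1)) y
      (rElt_injective hT (by rw [← d_rElt, hy, map_sub, c'.2.2, c''.2.2, sub_self, map_zero]))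
    obtain ⟨t', rfl⟩ : ∃ t', mapElt (tensorPerf R W) (diskToSphere R 1 (i - 1)) (i - 1) t' = t := by
      have := isIso_diskToSphere (R := R) (k := 1) (i - 1)
      exact (ModuleCat.epi_iff_surjective _).1 (inferInstanceAs (Epi
        ((tensorFunctor R W).map ((diskToSphere R 1 (i - 1)).hom.f (i - 1))))) t
    obtain ⟨t'', ht⟩ : ∃ t'', mapElt (tensorPerf R W) (sphereToDisk R 1 (i - 1 - 1) (i - 1))
        (i - 1 - 1) t'' = (((tensorPerf R W).obj _).d (i - 1) (i - 1 - 1)).hom t' := by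
      have := isIso_sphereToDisk (R := R) (k := 1) (sub_add_cancel (i - 1) 1)
      exact (ModuleCat.epi_iff_surjective _).1 (inferInstanceAs (Epi
        ((tensorFunctor R W).map ((sphereToDisk R 1 (i - 1 - 1) (i - 1)).hom.f (i - 1 - 1))))) _
    -- Since $b$ anticommutes with $d$, adding $rb(t')$ to $x$ changes $dx$ by $-rb(dt')$, which the
    -- correction of `c` absorbs.
    refine ⟨⟨c.1 + T.rElt _ (i - 1) (bElt φ _ (i - 1) t''), ?_, ?_⟩,
      x + T.rElt _ i (bElt φ _ i t'), ?_, ?_, ?_⟩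
    · rw [map_add, c.2.1, arElt_rElt, aElt_bElt, map_zero, add_zero]
    · have h0 : (sphere R 1 (i - 1 - 1)).obj.d (i - 1 - 1) (i - 1 - 1 - 1) = 0 :=
        ModuleCat.hom_ext (LinearMap.ext fun x => sphere_d x)
      have h : (((tensorPerf R W).obj (sphere R 1 (i - 1 - 1))).d (i - 1 - 1)
          (i - 1 - 1 - 1)).hom t'' = 0 :=
        (congrArg (fun f => ((tensorFunctor R W).map f).hom t'') h0).trans
          (by rw [Functor.map_zero]; rfl)
      rw [map_add, c.2.2, d_rElt, d_bElt, h, map_zero, neg_zero, map_zero, add_zero]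
    · rw [map_add, hx, mapElt_rElt, mapElt_bElt, hy, add_sub_cancel]
    · rw [map_add, hax, arElt_rElt, aElt_bElt, map_zero, add_zero]
    · rw [map_add, hdx, d_rElt, d_bElt, map_add, mapElt_rElt, mapElt_bElt, ht, map_neg]
      abel
  obtain ⟨c, hc⟩ := exists_int_chain P (hα 0).some up down
  choose x hx hax hdx using hc
  exact ⟨fun i => (c i).1, x, hx, hax, hdx⟩

theorem exists_section (hT : T.IsStrict) (s : NaturalSection φ) :
    ∃ g : ∀ (V : Perf R) (i : ℤ), V.obj.X (i - 1) → (T.Cr.obj V).X i,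
    (∀ (V V' : Perf R) (p : V ⟶ V') (i : ℤ) (v : V.obj.X (i - 1)),
      mapElt T.Cr p i (g V i v) = g V' i ((p.hom.f (i - 1)).hom v)) ∧
    (∀ (V : Perf R) (i : ℤ), g V i 0 = 0) ∧
    (∀ (V : Perf R) (i : ℤ) (v : V.obj.X (i - 1)), T.arElt V i (g V i v) = coneInl V i v) ∧
    ∀ (V : Perf R) (i : ℤ) (v : V.obj.X (i - 1)), ((T.Cr.obj V).d i (i - 1)).hom (g V i v) =
      T.rElt V (i - 1) (s.τ (i - 1) V v) -
        g V (i - 1) ((V.obj.d (i - 1) (i - 1 - 1)).hom v) := by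
  obtain ⟨c, x, hxc, hax, hdx⟩ := exists_lifts hT s
  refine ⟨fun V i v => mapElt T.Cr (diskHom fun _ => v) i (x i), fun V V' p i v => ?_,
    fun V i => mapElt_diskHom_zero T.pointed (fun _ => rfl) _, fun V i v => ?_, fun V i v => ?_⟩
  · rw [mapElt_comp, diskHom_comp]
  · rw [arElt_mapElt, hax, map_coneInl, diskHom_gen]
  · rw [d_mapElt, hdx, map_sub, mapElt_rElt, s.natural, diskHom_gen, ← hxc, mapElt_comp,
      mapElt_comp, diskHom_comp]
    congr 4
    funext a
    change ((diskHom fun _ => v).hom.f (i - 1 - 1)).hom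
      (((sphereToDisk R 1 (i - 1 - 1) (i - 1)).hom.f (i - 1 - 1)).hom _) = _
    rw [sphereHom_gen, ← hom_d_comm, diskHom_gen]

theorem IsIsomorphic.symm {T T' : RightSplitting φ} (h : T.IsIsomorphic T') :
    T'.IsIsomorphic T := by
  obtain ⟨e, h₁, h₂⟩ := h
  exact ⟨e.symm, by rw [← h₁, Category.assoc, e.symm_hom, e.hom_inv_id, Category.comp_id],
    by rw [← h₂, e.symm_hom, e.inv_hom_id_assoc]⟩

theorem IsIsomorphic.trans {T T' T'' : RightSplitting φ} (h : T.IsIsomorphic T')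
    (h' : T'.IsIsomorphic T'') : T.IsIsomorphic T'' := by
  obtain ⟨e, h₁, h₂⟩ := h
  obtain ⟨e', h₁', h₂'⟩ := h'
  exact ⟨e ≪≫ e', by rw [Iso.trans_hom, ← Category.assoc, h₁, h₁'],
    by rw [Iso.trans_hom, Category.assoc, h₂', h₂]⟩

end RightSplitting

/-! ### Uniqueness: comparison with the model. -/

namespace CocycleSection

variable {R : Type u} [Ring R] {W : Type u} [AddCommGroup W] [Module Rᵐᵒᵖ W]
  {φ : ElementaryExtension R W} (s : CocycleSection φ)

open RightSplitting

-- The discrepancy is killed by $a^r$, so strictness writes it as $r\psi$; injectivity of $r$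
-- transfers the hypotheses of `eq_zero_of_natural` to $\psi$.
variable {s} in
theorem section_add_section {T : RightSplitting φ} (hT : T.IsStrict)
    {g : ∀ (V : Perf R) (i : ℤ), V.obj.X (i - 1) → (T.Cr.obj V).X i}
    (nat : ∀ (V V' : Perf R) (p : V ⟶ V') (i : ℤ) (v : V.obj.X (i - 1)),
      mapElt T.Cr p i (g V i v) = g V' i ((p.hom.f (i - 1)).hom v))
    (g_zero : ∀ (V : Perf R) (i : ℤ), g V i 0 = 0)
    (har : ∀ (V : Perf R) (i : ℤ) (v : V.obj.X (i - 1)), T.arElt V i (g V i v) = coneInl V i v)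
    (hd : ∀ (V : Perf R) (i : ℤ) (v : V.obj.X (i - 1)), ((T.Cr.obj V).d i (i - 1)).hom (g V i v) =
      T.rElt V (i - 1) (s.τ (i - 1) V v) - g V (i - 1) ((V.obj.d (i - 1) (i - 1 - 1)).hom v))
    (V : Perf R) (i : ℤ) (v w : V.obj.X (i - 1)) : g V i v + g V i w = g V i (v + w) +
      T.rElt V i (s.σ (i - 1) i (sub_add_cancel i 1) V v w) := by
  have hex (i : ℤ) (V : Perf R) (v : Fin 2 → V.obj.X (i - 1)) : ∃ y, T.rElt V i y =
      g V i (v 0) + g V i (v 1) - g V i (v 0 + v 1) -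
        T.rElt V i (s.σ (i - 1) i (sub_add_cancel i 1) V (v 0) (v 1)) := by
    obtain ⟨y, hy, -⟩ := exists_rElt_eq hT (w := 0) (y := g V i (v 0) + g V i (v 1) -
        g V i (v 0 + v 1) - T.rElt V i (s.σ (i - 1) i (sub_add_cancel i 1) V (v 0) (v 1))) (by
      rw [map_sub, map_sub, map_add, har, har, har, arElt_rElt, s.a_σ, map_add, sub_self, map_zero,
        sub_zero])
    exact ⟨y, hy⟩
  obtain ⟨ψ, hψ⟩ : ∃ ψ : ∀ m n : ℤ, m + 1 = n → ∀ V : Perf R, (Fin 2 → V.obj.X m) →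
      (φ.C.obj V).X n, ∀ (i : ℤ) (V : Perf R) (v : Fin 2 → V.obj.X (i - 1)),
      T.rElt V i (ψ (i - 1) i (sub_add_cancel i 1) V v) =
      g V i (v 0) + g V i (v 1) - g V i (v 0 + v 1) -
        T.rElt V i (s.σ (i - 1) i (sub_add_cancel i 1) V (v 0) (v 1)) := by
    choose y hy using hex
    exact ⟨fun m n h => by obtain rfl := eq_sub_of_add_eq h; exact y n, hy⟩
  have h := hψ i V ![v, w]
  rw [eq_zero_of_natural ψ ?_ ?_ ?_, map_zero, eq_comm, sub_eq_zero, sub_eq_iff_eq_add'] at h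
  · exact h
  · intro m n h V V' p v
    obtain rfl := eq_sub_of_add_eq h
    refine rElt_injective hT ?_
    rw [← mapElt_rElt, hψ, hψ]
    simp only [map_sub, map_add, nat, mapElt_rElt, s.σ_natural]
  · intro l m n h h' V v
    obtain rfl := eq_sub_of_add_eq h
    obtain rfl := eq_sub_of_add_eq h'
    refine rElt_injective hT ?_
    rw [← d_rElt, hψ, map_neg, hψ]
    simp only [map_sub, map_add, hd, d_rElt, s.d_σ _ _ _ h' h]
    abel
  · intro m n h V v a hv
    obtain rfl := eq_sub_of_add_eq h
    refine rElt_injective hT ?_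
    rw [hψ, map_zero]
    fin_cases a
    · rw [hv 1 (by decide), s.σ_zero_right, g_zero]
      simp
    · rw [hv 0 (by decide), s.σ_symm, s.σ_zero_right, g_zero]
      simp

theorem isIsomorphic_of_isStrict {T : RightSplitting φ} (hT : T.IsStrict) :
    s.splitting.IsIsomorphic T := by
  obtain ⟨g, nat, g_zero, har, hd⟩ := exists_section hT s.toNaturalSection
  let f : s.functor ⟶ T.Cr := descHom T.r g (section_add_section hT nat g_zero har hd) nat hd
  have f_incl {V : Perf R} {i : ℤ} (x : (φ.C.obj V).X i) :
      ((f.app V).f i).hom (s.inclElt V i x) = T.rElt V i x := descHom_inclElt _ _ _ _ _ x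
  have f_sec {V : Perf R} {i : ℤ} (v : V.obj.X (i - 1)) :
      ((f.app V).f i).hom (s.secElt V i v) = g V i v := descHom_secElt _ _ _ _ _ v
  -- The shifted coordinate of $a^r$ recovers $v$; what remains lies in the image of the injective
  -- map $r$.
  have hf (V : Perf R) (i : ℤ) : Function.Bijective ((f.app V).f i).hom := by
    constructor
    · rw [injective_iff_map_eq_zero]
      intro x hx
      obtain ⟨y, v, rfl⟩ := exists_eq_inclElt_add x
      rw [map_add, f_incl, f_sec] at hx
      have h := congrArg (T.arElt V i) hx
      rw [map_add, arElt_rElt, har, map_zero, add_comm] at h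
      obtain ⟨rfl, -⟩ := cone_eq_zero h
      rw [g_zero, add_zero] at hx
      rw [rElt_injective hT (hx.trans (map_zero _).symm), map_zero, secElt_zero, add_zero]
    · intro t
      obtain ⟨v, w, h⟩ := exists_cone_eq (T.arElt V i t)
      obtain ⟨x, hx, -⟩ := exists_rElt_eq hT (y := t - g V i v) (w := w) (by
        rw [map_sub, h, har, add_sub_cancel_left])
      exact ⟨s.inclElt V i x + s.secElt V i v, by rw [map_add, f_incl, f_sec, hx, sub_add_cancel]⟩
  have (V : Perf R) (i : ℤ) : IsIso ((f.app V).f i) :=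
    (ConcreteCategory.isIso_iff_bijective _).2 (hf V i)
  have (V : Perf R) : IsIso (f.app V) := HomologicalComplex.Hom.isIso_of_components _
  have : IsIso f := NatIso.isIso_of_isIso_app f
  refine ⟨@asIso _ _ s.functor T.Cr f this, ?_, ?_⟩
  · ext V i x
    exact f_incl x
  · refine NatTrans.ext (funext fun V => HomologicalComplex.hom_ext _ _ fun i =>
      ModuleCat.hom_ext (LinearMap.ext fun x => ?_))
    change T.arElt V i (((f.app V).f i).hom x) = ((s.ar.app V).f i).hom x
    obtain ⟨y, v, rfl⟩ := exists_eq_inclElt_add x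
    rw [map_add, map_add, f_incl, f_sec, map_add, arElt_rElt, har, ar_inclElt, ar_secElt]

end CocycleSection

end

end DGSplitting

theorem mainTheorem8 (R : Type u) [Ring R] (W : Type u) [AddCommGroup W] [Module Rᵐᵒᵖ W]
    (φ : DGSplitting.ElementaryExtension R W) :
    (∃ s : DGSplitting.RightSplitting φ, s.IsStrict ∧ DGSplitting.IsAdmissible s.Cr) ∧
    ∀ s t : DGSplitting.RightSplitting φ, s.IsStrict → t.IsStrict → s.IsIsomorphic t := by
  obtain ⟨c⟩ := DGSplitting.nonempty_cocycleSection φ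
  exact ⟨⟨c.splitting, c.isStrict, c.isAdmissible⟩, fun s t hs ht =>
    (c.isIsomorphic_of_isStrict hs).symm.trans (c.isIsomorphic_of_isStrict ht)⟩
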